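/- Let $n\ge 3$, let $D=(\mathcal W_0,\dots,\mathcal W_n)\in\mathbb C^{n+1}$ with $D\neq 0$, and let $P_D=\mathcal W_0Z_0+\dots+\mathcal W_nZ_n$. Let $$m(P_D)=\frac1{(2\pi)^{n+1}}\int_{[0,2\pi]^{n+1}}\log\bigl|P_D(e^{i\theta_0},\dots,e^{i\theta_n})\bigr|\,d\theta_0\cdots d\theta_n$$ be its logarithmic Mahler measure. Put $\|D\|^2=\sum_{m=0}^n|\mathcal W_m|^2$, $c(D)=\sqrt{(n+1)\|D\|^2}$ and $$a(n,k,D)=\sum_{\ell_0+\dots+\ell_n=k,\ \ell_m\ge0}\binom{k}{\ell_0,\dots,\ell_n}^2|\mathcal W_0|^{2\ell_0}\cdots|\mathcal W_n|^{2\ell_n},$$ and for $N\ge1$ let $$E_1(N;n,D)=\log c(D)-\frac12\sum_{j=1}^N\frac1j\sum_{k=0}^j\binom jk\frac{(-1)^ka(n,k,D)}{c(D)^{2k}},$$ $$E_2(N;n,D)=\log c(D)-\frac12-\frac12\sum_{j=1}^N\frac{2j+1}{j(j+1)}\sum_{k=0}^j\binom{j+k}k\binom jk\frac{(-1)^ka(n,k,D)}{c(D)^{2k}}.$$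 Let $J_0(x)=\sum_{k\ge0}\frac{(-1)^k}{2^{2k}(k!)^2}x^{2k}$ be the Bessel function and $$G(n,D)=c(D)^2\int_0^\infty t\,\Bigl(\max\bigl\{1,\tfrac\pi2c(D)t\bigr\}\Bigr)^{-1/2}\prod_{m=0}^n\bigl|J_0(|\mathcal W_m|t)\bigr|\,dt\in[0,\infty].$$ Then $G(n,D)<\infty$ whenever at least four of the coefficients $\mathcal W_m$ are nonzero (in particular when all of them are), and for every integer $N\ge1$ $$\bigl|m(P_D)-E_1(N;n,D)\bigr|\le\frac{\Gamma(3/4)}3\,\frac{G(n,D)}{N^{3/4}}\qquad\text{and}\qquad\bigl|m(P_D)-E_2(N;n,D)\bigr|\le2\sqrt[4]{2}\,\frac{G(n,D)}{\sqrt N},$$ where both bounds are understood as void when $G(n,D)=\infty$. -/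

import Mathlib

open scoped ENNReal

namespace LinearMahler

noncomputable section

/-- The Mahler measure of a polynomial in `d` variables: the exponential of the mean of
`log |P|` over the `d`-dimensional torus, parametrized by `[0, 2π]^d`. -/
def mahlerMeasure {d : ℕ} (P : MvPolynomial (Fin d) ℂ) : ℝ :=
  Real.exp ((1 / (2 * Real.pi) ^ d) *
    ∫ θ in Set.Icc (0 : Fin d → ℝ) (fun _ => 2 * Real.pi),
      Real.log ‖MvPolynomial.eval (fun i => Complex.exp (Complex.I * (θ i : ℂ))) P‖)

/-- The logarithmic Mahler measure `m(P) = log M(P)`. -/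
def logMahlerMeasure {d : ℕ} (P : MvPolynomial (Fin d) ℂ) : ℝ :=
  Real.log (mahlerMeasure P)

/-- The linear form `P_D = W₀ Z₀ + ⋯ + Wₙ Zₙ` with coefficient vector `D = (W₀, …, Wₙ)`. -/
def linearForm {n : ℕ} (D : Fin (n + 1) → ℂ) : MvPolynomial (Fin (n + 1)) ℂ :=
  ∑ i, MvPolynomial.C (D i) * MvPolynomial.X i

/-- `c(D)`, with `c(D)² = (n + 1) ‖D‖²` and `‖D‖² = |W₀|² + ⋯ + |Wₙ|²`. -/
def c {n : ℕ} (D : Fin (n + 1) → ℂ) : ℝ :=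
  Real.sqrt (((n : ℝ) + 1) * ∑ i, ‖D i‖ ^ 2)

/-- `a(n, k, D)`: the sum over `ℓ₀ + ⋯ + ℓₙ = k` of the squared multinomial coefficients times
`|W₀|^(2ℓ₀) ⋯ |Wₙ|^(2ℓₙ)`. -/
def a {n : ℕ} (k : ℕ) (D : Fin (n + 1) → ℂ) : ℝ :=
  ∑ l ∈ Finset.piAntidiag (Finset.univ : Finset (Fin (n + 1))) k,
    (Nat.multinomial Finset.univ l : ℝ) ^ 2 * ∏ i, ‖D i‖ ^ (2 * l i)

/-- The partial sum `E₁(N; n, D)`. -/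
def E₁ {n : ℕ} (N : ℕ) (D : Fin (n + 1) → ℂ) : ℝ :=
  Real.log (c D) - 1 / 2 * ∑ j ∈ Finset.Icc 1 N, 1 / (j : ℝ) *
    ∑ k ∈ Finset.range (j + 1),
      (j.choose k : ℝ) * ((-1) ^ k * a k D / c D ^ (2 * k))

/-- The partial sum `E₂(N; n, D)`. -/
def E₂ {n : ℕ} (N : ℕ) (D : Fin (n + 1) → ℂ) : ℝ :=
  Real.log (c D) - 1 / 2 - 1 / 2 * ∑ j ∈ Finset.Icc 1 N,
    (2 * (j : ℝ) + 1) / ((j : ℝ) * ((j : ℝ) + 1)) *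
      ∑ k ∈ Finset.range (j + 1),
        ((j + k).choose k : ℝ) * (j.choose k : ℝ) * ((-1) ^ k * a k D / c D ^ (2 * k))

/-- The Bessel function `J₀` on the real line, by its (everywhere convergent) power series. -/
def besselJ0 (x : ℝ) : ℝ :=
  ∑' k : ℕ, (-1) ^ k / (2 ^ (2 * k) * (k.factorial : ℝ) ^ 2) * x ^ (2 * k)

/-- The constant
`G(n, D) = c(D)² ∫₀^∞ t max{1, (π/2) c(D) t}^(-1/2) ∏ₘ |J₀(|Wₘ| t)| dt`.
The integrand is nonnegative, and `G(n, D)` is taken in `[0, ∞]`: the integral diverges when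
fewer than four of the coefficients are nonzero. -/
def G {n : ℕ} (D : Fin (n + 1) → ℂ) : ℝ≥0∞ :=
  ENNReal.ofReal (c D ^ 2) * ∫⁻ t in Set.Ioi (0 : ℝ),
    ENNReal.ofReal (t * (max 1 (Real.pi / 2 * c D * t)) ^ (-(1 / 2) : ℝ) *
      ∏ i, |besselJ0 (‖D i‖ * t)|)

end

end LinearMahler

namespace LinearMahler

open MeasureTheory Filter Topology Set

/-! Give the torus its Haar probability measure and put U = |P_D|²/c(D)². By Cauchy–Schwarz U lies
in [0, 1], and m(P_D) = log c(D) + (1/2) E[log U]. Since E[U^k] = a(n,k,D)/c(D)^(2k), replacing log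
v by its Taylor polynomial at v = 1 gives E₁, and replacing it by its truncated shifted Legendre
expansion gives E₂. Each error is therefore half the expectation of an explicit remainder, up to
sign, and everything rests on controlling the law of U.

The law of P_D is a convolution of uniform measures on circles, whose Fourier transforms are the
functions J₀(|W_m| t). Its density at z should be (1/2π) ∫ t J₀(t|z|) ∏ J₀(|W_m| t) dt. The bound
|J₀(x)| ≤ max{1, πx/2}^(-1/2), proved by a contour shift, makes this at most (1/2π) max{1,
c/|z|}^(1/2) times the integral in G. The inversion is made rigorous by smoothing with Gaussians,
whose Hankel transforms are Gaussians: the bound is uniform in the width, and letting the width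
shrink yields `map_torusValue_le`. In polar coordinates it says that U has density at most (G/2)
v^(-1/4) on (0, 1], which is `lintegral_normSq_torusValue_le`.

It remains to bound ∫₀¹ v^(-1/4) |R_N(v)| dv. For the Taylor remainder, integration by parts leads
to ∫ v^(-1/4) (1-v)^N dv ≤ Γ(3/4) N^(-3/4). For the Legendre remainder, orthogonality gives the
exact L² norm 1/(N+1), and pairing it with v^(-1/4), which is in L²(0, 1), gives a bound of order
1/N, better than the order N^(-1/2) that is claimed. -/

/-! ### Integral representations of J₀. -/

/-- The normalized Lebesgue measure on `(0, 2π]`. -/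
noncomputable def angleMeasure : Measure ℝ :=
  ENNReal.ofReal (1 / (2 * Real.pi)) • volume.restrict (Ioc 0 (2 * Real.pi))

instance : IsProbabilityMeasure angleMeasure := by
  constructor
  rw [angleMeasure, Measure.smul_apply, Measure.restrict_apply_univ, Real.volume_Ioc, smul_eq_mul,
    ← ENNReal.ofReal_mul (by positivity)]
  have := Real.pi_pos
  rw [show 1 / (2 * Real.pi) * (2 * Real.pi - 0) = 1 by field_simp; ring, ENNReal.ofReal_one]

theorem integral_angleMeasure {E : Type*} [NormedAddCommGroup E] [NormedSpace ℝ E] (f : ℝ → E) :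
    ∫ θ, f θ ∂angleMeasure = (1 / (2 * Real.pi)) • ∫ θ in (0)..(2 * Real.pi), f θ := by
  have := Real.pi_pos
  rw [angleMeasure, integral_smul_measure, intervalIntegral.integral_of_le (by positivity),
    ENNReal.toReal_ofReal (by positivity)]

theorem integral_angleMeasure_sub {E : Type*} [NormedAddCommGroup E] [NormedSpace ℝ E]
    {f : ℝ → E} (hf : Function.Periodic f (2 * Real.pi)) (α : ℝ) :
    ∫ θ, f (θ - α) ∂angleMeasure = ∫ θ, f θ ∂angleMeasure := by
  rw [integral_angleMeasure, integral_angleMeasure, intervalIntegral.integral_comp_sub_right]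
  congr 1
  have := hf.intervalIntegral_add_eq (0 - α) 0
  simpa [sub_eq_add_neg, add_comm] using this

theorem integrable_angleMeasure_of_continuous {E : Type*} [NormedAddCommGroup E]
    {f : ℝ → E} (hf : Continuous f) : Integrable f angleMeasure := by
  refine Integrable.smul_measure ?_ ENNReal.ofReal_ne_top
  exact (hf.integrableOn_Icc (μ := volume)).mono_set Ioc_subset_Icc_self

theorem integral_cos_pow_even (k : ℕ) :
    ∫ θ, Real.cos θ ^ (2 * k) ∂angleMeasure
      = ((2 * k).factorial : ℝ) / (4 ^ k * (k.factorial : ℝ) ^ 2) := by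
  induction k with
  | zero => simp
  | succ k ih =>
    rw [integral_angleMeasure] at ih ⊢
    rw [show 2 * (k + 1) = 2 * k + 2 by ring, integral_cos_pow]
    simp only [Real.sin_two_pi, Real.sin_zero, mul_zero, sub_zero, zero_div, zero_add,
      smul_eq_mul] at ih ⊢
    rw [show 1 / (2 * Real.pi) * (((2 * k : ℕ) + 1 : ℝ) / ((2 * k : ℕ) + 2) *
      ∫ x in (0)..(2 * Real.pi), Real.cos x ^ (2 * k)) = ((2 * k : ℕ) + 1 : ℝ) / ((2 * k : ℕ) + 2) *
      (1 / (2 * Real.pi) * ∫ x in (0)..(2 * Real.pi), Real.cos x ^ (2 * k)) by ring, ih]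
    rw [show 2 * k + 2 = (2 * k + 1) + 1 by ring]
    simp only [Nat.factorial_succ]
    push_cast
    field_simp
    ring

/-- Expand cos(x cos θ) in its power series and integrate termwise: the even moments of the cosine
turn (2k)! into 4^k (k!)². -/
theorem hasSum_besselJ0 (x : ℝ) :
    HasSum (fun k : ℕ => (-1) ^ k / (2 ^ (2 * k) * (k.factorial : ℝ) ^ 2) * x ^ (2 * k))
      (∫ θ, Real.cos (x * Real.cos θ) ∂angleMeasure) := by
  have hcont : ∀ k : ℕ, Continuous
      fun θ : ℝ => (-1 : ℝ) ^ k * (x * Real.cos θ) ^ (2 * k) / ((2 * k).factorial : ℝ) :=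
    fun k => by fun_prop
  have hs : Summable fun k : ℕ => |x| ^ (2 * k) / ((2 * k).factorial : ℝ) :=
    (Real.summable_pow_div_factorial |x|).comp_injective
      (fun a b h => by simpa using h)
  have h := hasSum_integral_of_summable_integral_norm (μ := angleMeasure)
    (fun k => integrable_angleMeasure_of_continuous (hcont k)) ?_
  · have h2 : ∀ θ : ℝ, ∑' k : ℕ, (-1 : ℝ) ^ k * (x * Real.cos θ) ^ (2 * k) /
        ((2 * k).factorial : ℝ) = Real.cos (x * Real.cos θ) := fun θ => (Real.hasSum_cos _).tsum_eq
    simp_rw [h2] at h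
    have e : ∀ k : ℕ, ∫ θ, (-1 : ℝ) ^ k * (x * Real.cos θ) ^ (2 * k) /
        ((2 * k).factorial : ℝ) ∂angleMeasure =
        (-1) ^ k / (2 ^ (2 * k) * (k.factorial : ℝ) ^ 2) * x ^ (2 * k) := by
      intro k
      have : (fun θ : ℝ => (-1 : ℝ) ^ k * (x * Real.cos θ) ^ (2 * k) / ((2 * k).factorial : ℝ)) =
          fun θ => ((-1 : ℝ) ^ k * x ^ (2 * k) / ((2 * k).factorial : ℝ)) *
            Real.cos θ ^ (2 * k) := by
        ext θ; rw [mul_pow]; ring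
      rw [this, integral_const_mul, integral_cos_pow_even, pow_mul 2 2 k]
      have : ((2 * k).factorial : ℝ) ≠ 0 := by positivity
      field_simp
      norm_num
    simpa only [e] using h
  · refine hs.of_nonneg_of_le (fun k => by positivity) fun k => ?_
    have : ∀ θ : ℝ, ‖(-1 : ℝ) ^ k * (x * Real.cos θ) ^ (2 * k) / ((2 * k).factorial : ℝ)‖ ≤
        |x| ^ (2 * k) / ((2 * k).factorial : ℝ) := by
      intro θ
      rw [norm_div, norm_mul, norm_pow, norm_pow, norm_neg, norm_one, one_pow, one_mul, norm_mul,
        Real.norm_eq_abs, Real.norm_eq_abs, Real.norm_natCast]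
      gcongr
      exact mul_le_of_le_one_right (abs_nonneg _) (Real.abs_cos_le_one _)
    refine (integral_mono (integrable_angleMeasure_of_continuous (hcont k).norm)
      (integrable_const _) this).trans ?_
    simp

theorem besselJ0_eq_integral (x : ℝ) :
    besselJ0 x = ∫ θ, Real.cos (x * Real.cos θ) ∂angleMeasure :=
  (hasSum_besselJ0 x).tsum_eq

theorem continuous_besselJ0 : Continuous besselJ0 := by
  have : besselJ0 = fun x => ∫ θ, Real.cos (x * Real.cos θ) ∂angleMeasure :=
    funext besselJ0_eq_integral
  rw [this]
  refine continuous_of_dominated (bound := fun _ => 1) (fun x => ?_) (fun x => ?_)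
    (integrable_const _) ?_
  · exact (by fun_prop : Continuous fun θ => Real.cos (x * Real.cos θ)).aestronglyMeasurable
  · exact Eventually.of_forall fun θ => Real.abs_cos_le_one _
  · exact Eventually.of_forall fun θ => by fun_prop

theorem abs_besselJ0_le_one (x : ℝ) : |besselJ0 x| ≤ 1 := by
  rw [besselJ0_eq_integral, ← Real.norm_eq_abs]
  refine (norm_integral_le_of_norm_le_const (C := 1)
    (Eventually.of_forall fun θ => Real.abs_cos_le_one _)).trans ?_
  simp

/-- `J₀(|w|)` is the mean of the characters `exp(i Re(w e^{-iα}))`. -/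
theorem besselJ0_norm_eq_integral (w : ℂ) :
    (besselJ0 ‖w‖ : ℂ) =
      ∫ α : ℝ, Complex.exp (Complex.I * ((w * Complex.exp (-(Complex.I * α))).re : ℂ))
        ∂angleMeasure := by
  have hre : ∀ α : ℝ, (w * Complex.exp (-(Complex.I * α))).re = ‖w‖ * Real.cos (α - w.arg) := by
    intro α
    conv_lhs => rw [← Complex.norm_mul_exp_arg_mul_I w]
    rw [mul_assoc, ← Complex.exp_add, Complex.re_ofReal_mul, Complex.exp_re]
    simp
    left
    rw [← Real.cos_neg]
    ring_nf
  simp_rw [hre]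
  rw [integral_angleMeasure_sub
    (f := fun θ => Complex.exp (Complex.I * ((‖w‖ * Real.cos θ : ℝ) : ℂ)))
    (fun θ => by simp only [Real.cos_add_two_pi])]
  set r := ‖w‖
  have hsplit : ∀ θ : ℝ, Complex.exp (Complex.I * ((r * Real.cos θ : ℝ) : ℂ)) =
      ((Real.cos (r * Real.cos θ) : ℝ) : ℂ) + ((Real.sin (r * Real.cos θ) : ℝ) : ℂ) * Complex.I := by
    intro θ
    rw [mul_comm, Complex.exp_mul_I, Complex.ofReal_cos, Complex.ofReal_sin]
  simp_rw [hsplit]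
  rw [integral_add (integrable_angleMeasure_of_continuous (by fun_prop))
    (integrable_angleMeasure_of_continuous (by fun_prop)), integral_mul_const,
    integral_complex_ofReal, integral_complex_ofReal, besselJ0_eq_integral]
  -- Translation by π changes the sign of the integrand, so the imaginary part vanishes.
  have hsin : ∫ θ, Real.sin (r * Real.cos θ) ∂angleMeasure = 0 := by
    have h1 := integral_angleMeasure_sub (f := fun θ => Real.sin (r * Real.cos θ))
      (fun θ => by simp only [Real.cos_add_two_pi]) Real.pi
    simp only [Real.cos_sub_pi, mul_neg, Real.sin_neg, integral_neg] at h1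
    linarith
  rw [hsin]
  simp

/-- Folding the circle onto a quarter period makes the substitution u = sin θ injective, which
prepares the contour integral. -/
theorem besselJ0_eq_integral_sin (x : ℝ) :
    besselJ0 x = 2 / Real.pi * ∫ θ in (0)..(Real.pi / 2), Real.cos (x * Real.sin θ) := by
  have hc : Continuous fun θ => Real.cos (x * Real.sin θ) := by fun_prop
  have h1 := integral_angleMeasure_sub (f := fun θ => Real.cos (x * Real.cos θ))
      (fun θ => by simp only [Real.cos_add_two_pi]) (Real.pi / 2)
  simp only [Real.cos_sub_pi_div_two] at h1
  rw [besselJ0_eq_integral, ← h1, integral_angleMeasure]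
  set F := fun θ => Real.cos (x * Real.sin θ) with hF
  have hper : Function.Periodic F Real.pi := fun θ => by simp [hF, Real.sin_add_pi]
  have hii : ∀ a b, IntervalIntegrable F volume a b := fun a b => hc.intervalIntegrable a b
  have e1 : ∫ θ in (0)..(2 * Real.pi), F θ = 2 * ∫ θ in (0)..Real.pi, F θ := by
    rw [← intervalIntegral.integral_add_adjacent_intervals (hii 0 Real.pi) (hii _ _)]
    have := hper.intervalIntegral_add_eq Real.pi 0
    rw [zero_add, ← two_mul] at this
    rw [this]; ring
  have e2 : ∫ θ in (0)..Real.pi, F θ = 2 * ∫ θ in (0)..(Real.pi / 2), F θ := by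
    rw [← intervalIntegral.integral_add_adjacent_intervals (hii 0 (Real.pi / 2)) (hii _ _)]
    have : ∫ θ in (Real.pi / 2)..Real.pi, F θ = ∫ θ in (0)..(Real.pi / 2), F θ := by
      have h := intervalIntegral.integral_comp_sub_left (a := 0) (b := Real.pi / 2) F Real.pi
      rw [sub_zero, show Real.pi - Real.pi / 2 = Real.pi / 2 by ring] at h
      rw [← h]
      simp only [hF, Real.sin_pi_sub]
    rw [this]; ring
  rw [e1, e2, smul_eq_mul]
  have := Real.pi_pos
  field_simp

/-! ### Decay of J₀ by a contour shift. -/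

/-- Factor 1 - u² = (1 - u)(1 + u) and bound each factor below by its real or imaginary part. The
first estimate serves the vertical side of the contour, the second the top side. -/
theorem norm_one_sub_sq_ge (a b : ℝ) :
    |b| * |1 + a| ≤ ‖1 - ((a : ℂ) + b * Complex.I) ^ 2‖ ∧
      b ^ 2 ≤ ‖1 - ((a : ℂ) + b * Complex.I) ^ 2‖ := by
  have e : 1 - ((a : ℂ) + b * Complex.I) ^ 2 =
      (1 - ((a : ℂ) + b * Complex.I)) * (1 + ((a : ℂ) + b * Complex.I)) := by ring
  have h1 := Complex.abs_im_le_norm (1 - ((a : ℂ) + b * Complex.I))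
  have h2 := Complex.abs_im_le_norm (1 + ((a : ℂ) + b * Complex.I))
  have h3 := Complex.abs_re_le_norm (1 + ((a : ℂ) + b * Complex.I))
  simp at h1 h2 h3
  rw [e, norm_mul]
  refine ⟨by gcongr, ?_⟩
  rw [← sq_abs, sq]
  gcongr

/-- Cauchy's theorem for e^{ixu}(1-u²)^(-1/2) on the rectangle with corners 0, s, s+iR, iR; keeping
s < 1 avoids the branch point. The left side contributes nothing to the real part, the top is
O(e^{-xR}), and the right side is at most (1+s)^(-1/2) ∫ y^(-1/2) e^{-xy} dy, a value of Γ(1/2). -/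
theorem abs_integral_cos_div_sqrt_le {x s : ℝ} (hx : 0 < x) (hs0 : 0 ≤ s) (hs1 : s < 1) :
    |∫ u in (0)..s, Real.cos (x * u) * (1 - u ^ 2) ^ (-(1 / 2) : ℝ)| ≤
      Real.sqrt (Real.pi / ((1 + s) * x)) := by
  set f : ℂ → ℂ := fun u => Complex.exp (Complex.I * x * u) * (1 - u ^ 2) ^ ((-(1 / 2) : ℝ) : ℂ)
    with hf
  have hnorm : ∀ a b : ℝ, ‖f (a + b * Complex.I)‖ =
      Real.exp (-(x * b)) * ‖1 - ((a : ℂ) + b * Complex.I) ^ 2‖ ^ (-(1 / 2) : ℝ) := by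
    intro a b
    rw [hf]
    simp only [norm_mul, Complex.norm_cpow_real, Complex.norm_exp]
    congr 2
    simp
  have hslit : ∀ a b : ℝ, 0 ≤ a → a < 1 →
      1 - ((a : ℂ) + b * Complex.I) ^ 2 ∈ Complex.slitPlane := by
    intro a b h0 h1
    left
    simp [sq]
    nlinarith [mul_self_nonneg b]
  have hdiff : ∀ u : ℂ, 0 ≤ u.re → u.re < 1 → DifferentiableAt ℂ f u := by
    intro u h0 h1
    have := hslit u.re u.im h0 h1
    rw [Complex.re_add_im] at this
    rw [hf]
    refine DifferentiableAt.mul (by fun_prop) ?_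
    exact DifferentiableAt.cpow (by fun_prop) (by fun_prop) this
  have hcv : ∀ a : ℝ, 0 ≤ a → a < 1 → Continuous fun y : ℝ => f (a + y * Complex.I) := by
    intro a h0 h1
    refine continuous_iff_continuousAt.2 fun y => ?_
    refine ContinuousAt.comp (f := fun y : ℝ => (a : ℂ) + y * Complex.I)
      (hdiff _ (by simpa using h0) (by simpa using h1)).continuousAt (by fun_prop)
  have hrect : ∀ R : ℝ, 1 ≤ R →
      |∫ u in (0)..s, Real.cos (x * u) * (1 - u ^ 2) ^ (-(1 / 2) : ℝ)| ≤
        Real.exp (-(x * R)) * s + Real.sqrt (Real.pi / ((1 + s) * x)) := by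
    intro R hR
    have hR0 : 0 ≤ R := by linarith
    have hmem : ∀ u ∈ (uIcc (0 : ℂ).re ((s : ℂ) + R * Complex.I).re) ×ℂ
        (uIcc (0 : ℂ).im ((s : ℂ) + R * Complex.I).im), DifferentiableAt ℂ f u := by
      intro u hu
      have := hu.1
      simp [uIcc_of_le hs0] at this
      exact hdiff u this.1 (by linarith [this.2])
    have key := Complex.integral_boundary_rect_eq_zero_of_differentiableOn f 0
      ((s : ℂ) + R * Complex.I) (fun u hu => (hmem u hu).differentiableWithinAt)
    simp only [Complex.zero_re, Complex.zero_im, Complex.add_re, Complex.ofReal_re, Complex.mul_re,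
      Complex.I_re, mul_zero, Complex.ofReal_im, Complex.I_im, mul_one, sub_self, add_zero,
      Complex.add_im, Complex.mul_im, zero_add, Complex.ofReal_zero, zero_mul, smul_eq_mul] at key
    have hbase : (∫ u : ℝ in (0)..s, f u).re =
        ∫ u in (0)..s, Real.cos (x * u) * (1 - u ^ 2) ^ (-(1 / 2) : ℝ) := by
      have hci : IntervalIntegrable (fun u : ℝ => f u) volume 0 s := by
        refine ContinuousOn.intervalIntegrable fun u hu => ContinuousAt.continuousWithinAt ?_
        rw [uIcc_of_le hs0] at hu
        exact ContinuousAt.comp (f := fun y : ℝ => (y : ℂ))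
          (hdiff _ (by simpa using hu.1) (by simpa using hu.2.trans_lt hs1)).continuousAt
          (by fun_prop)
      have := Complex.reCLM.intervalIntegral_comp_comm hci
      simp only [Complex.reCLM_apply] at this
      rw [← this]
      refine intervalIntegral.integral_congr fun u hu => ?_
      rw [uIcc_of_le hs0] at hu
      have h1 : (0 : ℝ) ≤ 1 - u ^ 2 := by nlinarith [hu.1, hu.2]
      simp only [hf]
      rw [show (1 - (u : ℂ) ^ 2) = ((1 - u ^ 2 : ℝ) : ℂ) by push_cast; ring,
        ← Complex.ofReal_cpow h1, Complex.re_mul_ofReal, Complex.exp_re]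
      simp
    have hleft : (Complex.I * ∫ y : ℝ in (0)..R, f (y * Complex.I)).re = 0 := by
      have : ∀ y : ℝ, f (y * Complex.I) =
          ((Real.exp (-(x * y)) * (1 + y ^ 2) ^ (-(1 / 2) : ℝ) : ℝ) : ℂ) := by
        intro y
        simp only [hf]
        rw [show (1 - ((y : ℂ) * Complex.I) ^ 2) = ((1 + y ^ 2 : ℝ) : ℂ) by
            rw [mul_pow, Complex.I_sq]; push_cast; ring,
          ← Complex.ofReal_cpow (by positivity), Complex.ofReal_mul, Complex.ofReal_exp]
        congr 2
        rw [show Complex.I * x * (y * Complex.I) = (Complex.I * Complex.I) * (x * y) by ring,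
          Complex.I_mul_I]
        push_cast; ring
      simp_rw [this]
      rw [intervalIntegral.integral_ofReal]
      simp
    have htop : ‖∫ u : ℝ in (0)..s, f (u + R * Complex.I)‖ ≤ Real.exp (-(x * R)) * s := by
      have := intervalIntegral.norm_integral_le_of_norm_le_const (a := 0) (b := s)
        (f := fun u : ℝ => f (u + R * Complex.I)) (C := Real.exp (-(x * R))) ?_
      · simpa [abs_of_nonneg hs0] using this
      · intro u _
        rw [hnorm]
        refine mul_le_of_le_one_right (Real.exp_nonneg _) ?_
        refine Real.rpow_le_one_of_one_le_of_nonpos ?_ (by norm_num)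
        have := (norm_one_sub_sq_ge u R).2
        nlinarith
    have hright : ‖∫ y : ℝ in (0)..R, f (s + y * Complex.I)‖ ≤
        Real.sqrt (Real.pi / ((1 + s) * x)) := by
      have hs2 : 0 < 1 + s := by linarith
      have hG := Real.integral_rpow_mul_exp_neg_mul_Ioi (a := 1 / 2) (r := x) (by norm_num) hx
      have hintegrable : IntegrableOn (fun y : ℝ => (1 + s) ^ (-(1 / 2) : ℝ) *
          (y ^ ((1 / 2 : ℝ) - 1) * Real.exp (-(x * y)))) (Ioi 0) := by
        refine Integrable.const_mul ?_ _
        -- A non-integrable function has integral 0 by convention, whereas the Gamma formula gives a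
        -- positive value.
        by_contra hcon
        rw [integral_undef hcon] at hG
        have : 0 < (1 / x) ^ (1 / 2 : ℝ) * Real.Gamma (1 / 2) := by
          have := Real.Gamma_pos_of_pos (s := 1 / 2) (by norm_num)
          positivity
        linarith
      calc ‖∫ y : ℝ in (0)..R, f (s + y * Complex.I)‖
          ≤ ∫ y in (0)..R, ‖f (s + y * Complex.I)‖ :=
            intervalIntegral.norm_integral_le_integral_norm hR0
        _ = ∫ y in Ioc 0 R, ‖f (s + y * Complex.I)‖ := intervalIntegral.integral_of_le hR0
        _ ≤ ∫ y in Ioc 0 R, (1 + s) ^ (-(1 / 2) : ℝ) *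
            (y ^ ((1 / 2 : ℝ) - 1) * Real.exp (-(x * y))) := by
            refine setIntegral_mono_on ?_ (hintegrable.mono_set Ioc_subset_Ioi_self) measurableSet_Ioc ?_
            · exact ((hcv s hs0 hs1).norm.integrableOn_Icc).mono_set Ioc_subset_Icc_self
            · intro y hy
              rw [hnorm, mul_comm (y ^ _), mul_left_comm]
              refine mul_le_mul_of_nonneg_left ?_ (Real.exp_nonneg _)
              have h1 := (norm_one_sub_sq_ge s y).1
              rw [abs_of_pos hy.1, abs_of_pos hs2] at h1
              rw [show (1 / 2 : ℝ) - 1 = -(1 / 2) by norm_num,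
                ← Real.mul_rpow hs2.le hy.1.le]
              refine Real.rpow_le_rpow_of_nonpos (by have := hy.1; positivity) ?_ (by norm_num)
              linarith
        _ ≤ ∫ y in Ioi 0, (1 + s) ^ (-(1 / 2) : ℝ) *
            (y ^ ((1 / 2 : ℝ) - 1) * Real.exp (-(x * y))) := by
            refine setIntegral_mono_set hintegrable ?_ Ioc_subset_Ioi_self.eventuallyLE
            refine (ae_restrict_iff' measurableSet_Ioi).2 (Eventually.of_forall fun y hy => ?_)
            have : (0 : ℝ) < y := hy
            simp only [Pi.zero_apply]
            positivity
        _ = Real.sqrt (Real.pi / ((1 + s) * x)) := by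
            rw [integral_const_mul, hG, Real.Gamma_one_half_eq, Real.sqrt_div Real.pi_pos.le,
              Real.sqrt_mul hs2.le, Real.rpow_neg hs2.le, ← Real.sqrt_eq_rpow, ← Real.sqrt_eq_rpow,
              Real.sqrt_div zero_le_one, Real.sqrt_one]
            field_simp
    have hre := congrArg Complex.re key
    rw [Complex.sub_re, Complex.add_re, Complex.sub_re, hbase, hleft, Complex.zero_re] at hre
    have b1 := (Complex.abs_re_le_norm _).trans htop
    have b2 := (Complex.abs_re_le_norm (Complex.I * ∫ y : ℝ in (0)..R, f (s + y * Complex.I)))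
    rw [norm_mul, Complex.norm_I, one_mul] at b2
    have b3 := b2.trans hright
    rw [abs_le] at b1 b3 ⊢
    constructor <;> linarith
  have hlim : Tendsto (fun R : ℝ => Real.exp (-(x * R)) * s +
      Real.sqrt (Real.pi / ((1 + s) * x))) atTop (𝓝 (0 * s + Real.sqrt (Real.pi / ((1 + s) * x)))) := by
    refine Tendsto.add_const _ (Tendsto.mul_const _ ?_)
    exact Real.tendsto_exp_neg_atTop_nhds_zero.comp (tendsto_id.const_mul_atTop hx)
  rw [zero_mul, zero_add] at hlim
  exact ge_of_tendsto hlim ((eventually_ge_atTop 1).mono hrect)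

theorem abs_besselJ0_le_sqrt {x : ℝ} (hx : 0 < x) :
    |besselJ0 x| ≤ Real.sqrt (2 / (Real.pi * x)) := by
  have hpi := Real.pi_pos
  have hc : Continuous fun θ => Real.cos (x * Real.sin θ) := by fun_prop
  have hb : ∀ τ ∈ Ico 0 (Real.pi / 2), |∫ θ in (0)..τ, Real.cos (x * Real.sin θ)| ≤
      Real.sqrt (Real.pi / ((1 + Real.sin τ) * x)) := by
    intro τ hτ
    have hsin0 : 0 ≤ Real.sin τ := Real.sin_nonneg_of_nonneg_of_le_pi hτ.1 (by linarith [hτ.2])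
    have hsin1 : Real.sin τ < 1 := by
      rw [← Real.sin_pi_div_two]
      exact Real.sin_lt_sin_of_lt_of_le_pi_div_two (by linarith [hτ.1]) le_rfl hτ.2
    refine le_of_eq_of_le ?_ (abs_integral_cos_div_sqrt_le hx hsin0 hsin1)
    have hcos : ∀ θ ∈ uIcc 0 τ, 0 < Real.cos θ := by
      intro θ hθ
      rw [uIcc_of_le hτ.1] at hθ
      exact Real.cos_pos_of_mem_Ioo ⟨by linarith [hθ.1], by linarith [hθ.2, hτ.2]⟩
    have hsub := intervalIntegral.integral_comp_mul_deriv' (a := 0) (b := τ) (f := Real.sin)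
      (f' := Real.cos) (g := fun u => Real.cos (x * u) * (1 - u ^ 2) ^ (-(1 / 2) : ℝ))
      (fun θ _ => Real.hasDerivAt_sin θ) Real.continuous_cos.continuousOn ?_
    · rw [Real.sin_zero] at hsub
      rw [← hsub]
      congr 1
      refine intervalIntegral.integral_congr fun θ hθ => ?_
      have := hcos θ hθ
      simp only [Function.comp]
      rw [← Real.cos_sq', ← Real.rpow_natCast, ← Real.rpow_mul this.le]
      norm_num
      rw [Real.rpow_neg_one]
      field_simp
    · rintro u ⟨θ, hθ, rfl⟩
      have h1 := hcos θ hθ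
      have h2 : 1 - Real.sin θ ^ 2 ≠ 0 := by rw [← Real.cos_sq']; positivity
      refine ContinuousAt.continuousWithinAt (ContinuousAt.mul (by fun_prop) ?_)
      exact ContinuousAt.rpow_const (by fun_prop) (Or.inl h2)
  -- The integrand in u is singular at u = 1, so the endpoint π/2 is reached as a limit from the
  -- left. There 1 + sin τ becomes 2, which produces the sharp constant.
  have hlim : |∫ θ in (0)..(Real.pi / 2), Real.cos (x * Real.sin θ)| ≤
      Real.sqrt (Real.pi / ((1 + Real.sin (Real.pi / 2)) * x)) := by
    have hprim : Continuous fun τ => ∫ θ in (0)..τ, Real.cos (x * Real.sin θ) :=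
      intervalIntegral.continuous_primitive (fun a b => hc.intervalIntegrable a b) 0
    have hr : ContinuousAt (fun τ => Real.sqrt (Real.pi / ((1 + Real.sin τ) * x))) (Real.pi / 2) := by
      refine ContinuousAt.sqrt (ContinuousAt.div (by fun_prop) (by fun_prop) ?_)
      rw [Real.sin_pi_div_two]; positivity
    refine le_of_tendsto_of_tendsto (b := 𝓝[<] (Real.pi / 2))
      (hprim.abs.continuousAt.tendsto.mono_left nhdsWithin_le_nhds)
      (hr.tendsto.mono_left nhdsWithin_le_nhds) ?_
    filter_upwards [Ico_mem_nhdsLT (show 0 < Real.pi / 2 by positivity)] with τ hτ using hb τ hτ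
  rw [besselJ0_eq_integral_sin, abs_mul, abs_of_pos (by positivity)]
  refine (mul_le_mul_of_nonneg_left hlim (by positivity)).trans_eq ?_
  rw [Real.sin_pi_div_two, ← Real.sqrt_sq (show 0 ≤ 2 / Real.pi by positivity),
    ← Real.sqrt_mul (by positivity)]
  congr 1
  field_simp
  norm_num

/-- `|J₀(x)| ≤ max{1, πx/2}^(-1/2)` for `x ≥ 0`. -/
theorem abs_besselJ0_le_max {x : ℝ} (hx : 0 ≤ x) :
    |besselJ0 x| ≤ (max 1 (Real.pi / 2 * x)) ^ (-(1 / 2) : ℝ) := by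
  rcases le_total (Real.pi / 2 * x) 1 with h | h
  · rw [max_eq_left h, Real.one_rpow]
    exact abs_besselJ0_le_one x
  · rw [max_eq_right h]
    have hx0 : 0 < x := by
      rcases hx.eq_or_lt with h0 | h0
      · rw [← h0] at h; norm_num at h
      · exact h0
    refine (abs_besselJ0_le_sqrt hx0).trans_eq ?_
    rw [Real.rpow_neg (by positivity), ← Real.sqrt_eq_rpow, ← Real.sqrt_inv]
    congr 1
    field_simp

/-! ### Averages of J₀ over the torus. -/

/-- The normalized Haar measure of the torus, in angular coordinates. -/
noncomputable def torusMeasure (ι : Type*) [Fintype ι] : Measure (ι → ℝ) :=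
  Measure.pi fun _ => angleMeasure

instance {ι : Type*} [Fintype ι] : IsProbabilityMeasure (torusMeasure ι) := by
  unfold torusMeasure; infer_instance

/-- The value of the linear form with coefficients `D` at a point of the torus. -/
noncomputable def torusValue {ι : Type*} [Fintype ι] (D : ι → ℂ) (θ : ι → ℝ) : ℂ :=
  ∑ i, D i * Complex.exp (Complex.I * θ i)

theorem continuous_torusValue {ι : Type*} [Fintype ι] (D : ι → ℂ) : Continuous (torusValue D) := by
  unfold torusValue; fun_prop

theorem integral_exp_re_rotate (D : ℂ) (α : ℝ) :
    ∫ θ : ℝ, Complex.exp (Complex.I *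
      ((-(D * Complex.exp (Complex.I * θ)) * Complex.exp (-(Complex.I * α))).re : ℂ)) ∂angleMeasure
      = besselJ0 ‖D‖ := by
  have h := integral_angleMeasure_sub
    (f := fun θ : ℝ => Complex.exp (Complex.I * ((-(D * Complex.exp (Complex.I * θ))).re : ℂ)))
    (fun θ => by
      have : Complex.exp (Complex.I * ((θ + 2 * Real.pi : ℝ) : ℂ)) =
          Complex.exp (Complex.I * θ) := by
        rw [← Complex.exp_periodic (Complex.I * θ)]
        congr 1; push_cast; ring
      simp only [this]) α
  have e : ∀ θ : ℝ, -(D * Complex.exp (Complex.I * θ)) * Complex.exp (-(Complex.I * α)) =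
      -(D * Complex.exp (Complex.I * ((θ - α : ℝ) : ℂ))) := by
    intro θ
    rw [neg_mul, mul_assoc, ← Complex.exp_add]
    congr 3; push_cast; ring
  simp_rw [e]
  rw [h, ← norm_neg, ← Complex.norm_conj, besselJ0_norm_eq_integral]
  congr 1
  ext θ
  congr 3
  rw [← Complex.conj_re, ← neg_mul, map_mul, ← Complex.exp_conj]
  simp

/-- J₀(|w|) is a mean of characters over directions α. For fixed α the character factors over the
independent coordinates, and rotation invariance makes each factor's mean J₀(|D i|), independent of
α. -/
theorem integral_besselJ0_norm_sub {ι : Type*} [Fintype ι] (D : ι → ℂ) (z : ℂ) :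
    ∫ θ, besselJ0 ‖z - torusValue D θ‖ ∂torusMeasure ι = besselJ0 ‖z‖ * ∏ i, besselJ0 ‖D i‖ := by
  have hcv := continuous_torusValue D
  rw [← Complex.ofReal_inj, ← integral_complex_ofReal]
  simp_rw [besselJ0_norm_eq_integral (z - _)]
  rw [integral_integral_swap]
  · have hsplit : ∀ (α : ℝ) (θ : ι → ℝ), Complex.exp (Complex.I *
        (((z - torusValue D θ) * Complex.exp (-(Complex.I * α))).re : ℂ)) =
        Complex.exp (Complex.I * ((z * Complex.exp (-(Complex.I * α))).re : ℂ)) *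
        ∏ i, Complex.exp (Complex.I * ((-(D i * Complex.exp (Complex.I * θ i)) *
          Complex.exp (-(Complex.I * α))).re : ℂ)) := by
      intro α θ
      rw [← Complex.exp_sum, ← Complex.exp_add, ← Finset.mul_sum, ← mul_add]
      congr 2
      rw [← Complex.ofReal_sum, ← Complex.re_sum, ← Complex.ofReal_add, ← Complex.add_re,
        ← Finset.sum_mul, ← add_mul, Finset.sum_neg_distrib, ← sub_eq_add_neg]
      rfl
    simp_rw [hsplit, integral_const_mul]
    have hprod : ∀ α : ℝ, ∫ θ : ι → ℝ, ∏ i, Complex.exp (Complex.I *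
        ((-(D i * Complex.exp (Complex.I * θ i)) * Complex.exp (-(Complex.I * α))).re : ℂ))
        ∂torusMeasure ι = ∏ i, (besselJ0 ‖D i‖ : ℂ) := by
      intro α
      rw [torusMeasure, integral_fintype_prod_eq_prod (f := fun i (x : ℝ) => Complex.exp (Complex.I *
        ((-(D i * Complex.exp (Complex.I * x)) * Complex.exp (-(Complex.I * α))).re : ℂ)))]
      simp_rw [integral_exp_re_rotate]
    simp_rw [hprod, integral_mul_const, ← besselJ0_norm_eq_integral]
    push_cast
    rfl
  · refine Integrable.of_bound (C := 1) ?_ (Eventually.of_forall fun p => ?_)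
    · refine Continuous.aestronglyMeasurable ?_
      have : Continuous fun p : (ι → ℝ) × ℝ => torusValue D p.1 := hcv.comp continuous_fst
      simp only [Function.uncurry_def]
      fun_prop
    · rw [Function.uncurry_apply_pair, mul_comm, Complex.norm_exp_ofReal_mul_I]

theorem integral_besselJ0_mul_norm_sub {ι : Type*} [Fintype ι] (D : ι → ℂ) (z : ℂ) {t : ℝ}
    (ht : 0 ≤ t) :
    ∫ θ, besselJ0 (t * ‖z - torusValue D θ‖) ∂torusMeasure ι =
      besselJ0 (t * ‖z‖) * ∏ i, besselJ0 (‖D i‖ * t) := by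
  have h := integral_besselJ0_norm_sub (fun i => (t : ℂ) * D i) (t * z)
  have e : ∀ θ, (t : ℂ) * z - torusValue (fun i => (t : ℂ) * D i) θ =
      t * (z - torusValue D θ) := by
    intro θ
    simp only [torusValue, mul_assoc, ← Finset.mul_sum, mul_sub]
  simp_rw [e, norm_mul, Complex.norm_real, Real.norm_eq_abs, abs_of_nonneg ht] at h
  simp_rw [mul_comm _ t]
  exact h

/-! ### Gaussian smoothing and Weber's integral. -/

theorem integrableOn_pow_mul_exp_neg_mul_sq {b : ℝ} (hb : 0 < b) (k : ℕ) :
    IntegrableOn (fun t : ℝ => t ^ k * Real.exp (-(b * t ^ 2))) (Ioi 0) := by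
  have hk : (0 : ℝ) ≤ k := k.cast_nonneg
  simpa only [Real.rpow_natCast, neg_mul] using
    integrableOn_rpow_mul_exp_neg_mul_sq hb (s := k) (by linarith)

theorem integral_odd_pow_mul_exp_neg_mul_sq {b : ℝ} (hb : 0 < b) (k : ℕ) :
    ∫ t in Ioi (0 : ℝ), t ^ (2 * k + 1) * Real.exp (-(b * t ^ 2)) =
      k.factorial / (2 * b ^ (k + 1)) := by
  have h := integral_rpow_mul_exp_neg_mul_rpow (p := 2) (q := (2 * k + 1 : ℕ)) (b := b)
    (by norm_num) (by have : (0 : ℝ) ≤ (2 * k + 1 : ℕ) := Nat.cast_nonneg _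
                      linarith) hb
  have e : (((2 * k + 1 : ℕ) : ℝ) + 1) / 2 = k + 1 := by push_cast; ring
  rw [neg_div, e, Real.Gamma_nat_eq_factorial, Real.rpow_neg hb.le] at h
  rw [show b ^ ((k : ℝ) + 1) = b ^ (k + 1) by rw [← Real.rpow_natCast]; push_cast; rfl] at h
  rw [show (k.factorial : ℝ) / (2 * b ^ (k + 1)) = (b ^ (k + 1))⁻¹ * (1 / 2) * k.factorial by
    field_simp, ← h]
  refine setIntegral_congr_fun measurableSet_Ioi fun t _ => ?_
  simp only [Real.rpow_natCast, Real.rpow_ofNat, neg_mul]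

/-- Weber's integral: the Hankel transform of a Gaussian. -/
theorem integral_mul_exp_mul_besselJ0 {b : ℝ} (hb : 0 < b) (r : ℝ) :
    ∫ t in Ioi (0 : ℝ), t * Real.exp (-((1 / (4 * b)) * t ^ 2)) * besselJ0 (t * r) =
      2 * b * Real.exp (-(b * r ^ 2)) := by
  set β := 1 / (4 * b) with hβ
  have hβ0 : 0 < β := by positivity
  set co : ℕ → ℝ := fun k => (-1) ^ k / (2 ^ (2 * k) * (k.factorial : ℝ) ^ 2) * r ^ (2 * k) with hco
  set F : ℕ → ℝ → ℝ := fun k t => co k * (t ^ (2 * k + 1) * Real.exp (-(β * t ^ 2))) with hF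
  have hval : ∀ k, ∫ t in Ioi (0 : ℝ), F k t = 2 * b * ((-(b * r ^ 2)) ^ k / k.factorial) := by
    intro k
    rw [hF]
    simp only
    rw [integral_const_mul, integral_odd_pow_mul_exp_neg_mul_sq hβ0, hco, hβ]
    have : (k.factorial : ℝ) ≠ 0 := by positivity
    simp only
    rw [neg_pow (b * r ^ 2), mul_pow b, ← pow_mul, pow_mul 2 2 k, div_pow, one_pow, mul_pow 4 b,
      pow_succ 4, pow_succ b]
    field_simp
    norm_num
    ring
  have hintegrable : ∀ k, IntegrableOn (F k) (Ioi 0) := fun k =>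
    (integrableOn_pow_mul_exp_neg_mul_sq hβ0 _).const_mul _
  have hnorm : ∀ k, ∫ t in Ioi (0 : ℝ), ‖F k t‖ = 2 * b * ((b * r ^ 2) ^ k / k.factorial) := by
    intro k
    have : ∀ t ∈ Ioi (0 : ℝ), ‖F k t‖ = (-1) ^ k * F k t := by
      intro t ht
      have ht0 : (0 : ℝ) < t := ht
      rw [hF, hco]
      simp only [norm_mul, norm_div, norm_pow, norm_neg, norm_one, one_pow, Real.norm_eq_abs,
        Real.abs_exp, abs_of_pos ht0, Nat.abs_cast, pow_mul |r| 2, sq_abs, abs_two]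
      rw [pow_mul r 2]
      have : ((-1 : ℝ) ^ k) * (-1) ^ k = 1 := by rw [← mul_pow]; norm_num
      linear_combination (-(1 / (2 ^ (2 * k) * (k.factorial : ℝ) ^ 2) * (r ^ 2) ^ k *
        (t ^ (2 * k + 1) * Real.exp (-(β * t ^ 2))))) * this
    rw [setIntegral_congr_fun measurableSet_Ioi this, integral_const_mul, hval,
      neg_pow (b * r ^ 2)]
    have : ((-1 : ℝ) ^ k) * (-1) ^ k = 1 := by rw [← mul_pow]; norm_num
    linear_combination (2 * b * ((b * r ^ 2) ^ k / k.factorial)) * this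
  have hsum := hasSum_integral_of_summable_integral_norm (μ := volume.restrict (Ioi 0)) hintegrable
    (by simp_rw [hnorm]; exact (Real.summable_pow_div_factorial _).mul_left _)
  have htot : ∀ t : ℝ, ∑' k, F k t = t * Real.exp (-(β * t ^ 2)) * besselJ0 (t * r) := by
    intro t
    rw [besselJ0, ← tsum_mul_left]
    congr 1
    ext k
    rw [hF, hco]
    simp only [mul_pow]
    ring
  simp_rw [htot, hval] at hsum
  have hexp : HasSum (fun k : ℕ => 2 * b * ((-(b * r ^ 2)) ^ k / k.factorial))
      (2 * b * Real.exp (-(b * r ^ 2))) := by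
    rw [Real.exp_eq_exp_ℝ]
    exact (NormedSpace.expSeries_div_hasSum_exp (-(b * r ^ 2))).mul_left _
  exact hsum.unique hexp

/-- Fubini combined with Weber's integral: this is Fourier inversion for the law of the form
smoothed by a Gaussian, up to the factor 2π. -/
theorem integral_gaussian_sub_torusValue {ι : Type*} [Fintype ι] (D : ι → ℂ) (z : ℂ) {b : ℝ}
    (hb : 0 < b) :
    ∫ θ, 2 * b * Real.exp (-(b * ‖z - torusValue D θ‖ ^ 2)) ∂torusMeasure ι =
      ∫ t in Ioi (0 : ℝ), t * Real.exp (-((1 / (4 * b)) * t ^ 2)) *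
        (besselJ0 (t * ‖z‖) * ∏ i, besselJ0 (‖D i‖ * t)) := by
  have hcv := continuous_torusValue D
  simp_rw [← integral_mul_exp_mul_besselJ0 hb]
  rw [integral_integral_swap]
  · refine setIntegral_congr_fun measurableSet_Ioi fun t ht => ?_
    rw [integral_const_mul, integral_besselJ0_mul_norm_sub _ _ (le_of_lt ht)]
  · have hg : Integrable (fun t : ℝ => t * Real.exp (-((1 / (4 * b)) * t ^ 2)))
        (volume.restrict (Ioi 0)) := by
      simpa only [pow_one, IntegrableOn] using
        integrableOn_pow_mul_exp_neg_mul_sq (b := 1 / (4 * b)) (by positivity) 1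
    refine (hg.comp_snd (torusMeasure ι)).mono ?_ (Eventually.of_forall fun p => ?_)
    · refine Continuous.aestronglyMeasurable ?_
      have h1 : Continuous fun p : (ι → ℝ) × ℝ => torusValue D p.1 := hcv.comp continuous_fst
      have h2 := continuous_besselJ0
      simp only [Function.uncurry_def]
      fun_prop
    · rw [Function.uncurry_apply_pair, norm_mul]
      exact mul_le_of_le_one_right (norm_nonneg _) (abs_besselJ0_le_one _)

/-- Trades the radius r for the fixed scale c, as in the definition of `G`; the price is the factor
max{1, c/r}^(1/2), which becomes the shape of the density bound. -/
theorem abs_besselJ0_le_mul_max {t r c : ℝ} (ht : 0 ≤ t) (hr : 0 < r) (hc : 0 < c) :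
    |besselJ0 (t * r)| ≤
      (max 1 (c / r)) ^ (1 / 2 : ℝ) * (max 1 (Real.pi / 2 * c * t)) ^ (-(1 / 2) : ℝ) := by
  have hpi := Real.pi_pos
  refine (abs_besselJ0_le_max (by positivity)).trans ?_
  have hM : 0 < max 1 (c / r) := lt_of_lt_of_le one_pos (le_max_left _ _)
  have hle : max 1 (Real.pi / 2 * c * t) ≤ max 1 (c / r) * max 1 (Real.pi / 2 * (t * r)) := by
    refine max_le (one_le_mul_of_one_le_of_one_le (le_max_left _ _) (le_max_left _ _)) ?_
    calc Real.pi / 2 * c * t = (c / r) * (Real.pi / 2 * (t * r)) := by field_simp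
      _ ≤ _ := by gcongr <;> exact le_max_right _ _
  have h1 : (0 : ℝ) < max 1 (Real.pi / 2 * c * t) := lt_of_lt_of_le one_pos (le_max_left _ _)
  have h2 : (0 : ℝ) < max 1 (Real.pi / 2 * (t * r)) := lt_of_lt_of_le one_pos (le_max_left _ _)
  have := Real.rpow_le_rpow_of_nonpos h1 hle (z := -(1 / 2)) (by norm_num)
  rw [Real.mul_rpow hM.le h2.le, Real.rpow_neg hM.le] at this
  rwa [inv_mul_le_iff₀ (by positivity)] at this

/-! ### The density bound for the values of the form. -/

/-- The integral in the definition of `G`. -/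
noncomputable def besselProductIntegral {n : ℕ} (D : Fin (n + 1) → ℂ) : ℝ≥0∞ :=
  ∫⁻ t in Set.Ioi (0 : ℝ),
    ENNReal.ofReal (t * (max 1 (Real.pi / 2 * c D * t)) ^ (-(1 / 2) : ℝ) *
      ∏ i, |besselJ0 (‖D i‖ * t)|)

theorem ofReal_integral_gaussian_le {n : ℕ} (D : Fin (n + 1) → ℂ) (hc : 0 < c D) {z : ℂ}
    (hz : z ≠ 0) {b : ℝ} (hb : 0 < b) :
    ENNReal.ofReal (∫ θ, 2 * b * Real.exp (-(b * ‖z - torusValue D θ‖ ^ 2))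
        ∂torusMeasure (Fin (n + 1))) ≤
      ENNReal.ofReal ((max 1 (c D / ‖z‖)) ^ (1 / 2 : ℝ)) * besselProductIntegral D := by
  rw [integral_gaussian_sub_torusValue D z hb, besselProductIntegral,
    ← lintegral_const_mul' _ _ ENNReal.ofReal_ne_top]
  refine (ENNReal.ofReal_le_ofReal (le_abs_self _)).trans ?_
  rw [← Real.norm_eq_abs, ofReal_norm]
  refine (enorm_integral_le_lintegral_enorm _).trans ?_
  refine setLIntegral_mono' measurableSet_Ioi fun t ht => ?_
  have ht0 : (0 : ℝ) < t := ht
  have hz0 : 0 < ‖z‖ := norm_pos_iff.2 hz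
  rw [← ofReal_norm, ← ENNReal.ofReal_mul (by positivity)]
  refine ENNReal.ofReal_le_ofReal ?_
  rw [norm_mul, norm_mul, norm_mul, Real.norm_eq_abs, Real.norm_eq_abs, abs_of_pos ht0,
    Real.abs_exp, Real.norm_eq_abs, Real.norm_eq_abs, Finset.abs_prod]
  -- Discarding the Gaussian factor makes the bound independent of `b`, so it survives the limit b →
  -- ∞.
  have h1 : Real.exp (-(1 / (4 * b) * t ^ 2)) ≤ 1 := by
    rw [Real.exp_le_one_iff]
    have : 0 ≤ 1 / (4 * b) * t ^ 2 := by positivity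
    linarith
  have h2 := abs_besselJ0_le_mul_max ht0.le hz0 hc
  have h3 : 0 ≤ ∏ i, |besselJ0 (‖D i‖ * t)| := Finset.prod_nonneg fun _ _ => abs_nonneg _
  calc t * Real.exp (-(1 / (4 * b) * t ^ 2)) *
        (|besselJ0 (t * ‖z‖)| * ∏ i, |besselJ0 (‖D i‖ * t)|)
      ≤ t * 1 * (((max 1 (c D / ‖z‖)) ^ (1 / 2 : ℝ) *
          (max 1 (Real.pi / 2 * c D * t)) ^ (-(1 / 2) : ℝ)) *
            ∏ i, |besselJ0 (‖D i‖ * t)|) := by gcongr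
    _ = _ := by ring

theorem norm_torusValue_le {n : ℕ} (D : Fin (n + 1) → ℂ) (θ : Fin (n + 1) → ℝ) :
    ‖torusValue D θ‖ ≤ c D := by
  have h1 : ‖torusValue D θ‖ ≤ ∑ i, ‖D i‖ := by
    refine (norm_sum_le _ _).trans_eq (Finset.sum_congr rfl fun i _ => ?_)
    rw [norm_mul, mul_comm Complex.I, Complex.norm_exp_ofReal_mul_I, mul_one]
  refine h1.trans (Real.le_sqrt_of_sq_le ?_)
  have := sq_sum_le_card_mul_sum_sq (s := Finset.univ) (f := fun i => ‖D i‖)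
  simpa using this

theorem c_pos {n : ℕ} {D : Fin (n + 1) → ℂ} (hD : D ≠ 0) : 0 < c D := by
  obtain ⟨i, hi⟩ := Function.ne_iff.1 hD
  have hi' : 0 < ‖D i‖ := norm_pos_iff.2 hi
  have : 0 < ∑ i, ‖D i‖ ^ 2 :=
    Finset.sum_pos' (fun _ _ => by positivity) ⟨i, Finset.mem_univ i, by positivity⟩
  exact Real.sqrt_pos.2 (by positivity)

theorem lintegral_comp_norm_complex {f : ℝ → ℝ≥0∞} (hf : Measurable f) :
    ∫⁻ z : ℂ, f ‖z‖ = ENNReal.ofReal (2 * Real.pi) * ∫⁻ r in Ioi (0 : ℝ), ENNReal.ofReal r * f r := by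
  rw [← Complex.lintegral_comp_polarCoord_symm, polarCoord_target]
  have : ∀ p ∈ Ioi (0 : ℝ) ×ˢ Ioo (-Real.pi) Real.pi,
      ENNReal.ofReal p.1 • f ‖Complex.polarCoord.symm p‖ = ENNReal.ofReal p.1 * f p.1 := by
    rintro p ⟨hp, -⟩
    rw [Complex.norm_polarCoord_symm, abs_of_pos hp, smul_eq_mul]
  rw [setLIntegral_congr_fun (measurableSet_Ioi.prod measurableSet_Ioo) this, Measure.volume_eq_prod,
    setLIntegral_prod _ (by fun_prop)]
  simp only [setLIntegral_const, Real.volume_Ioo]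
  rw [lintegral_mul_const' _ _ ENNReal.ofReal_ne_top, mul_comm]
  congr 2
  ring

/-- The Gaussian kernels concentrate: their mass on a neighbourhood of the centre tends to `1`. -/
theorem tendsto_lintegral_gaussian_ball (w : ℂ) {r : ℝ} (hr : 0 < r) :
    Tendsto (fun m : ℕ => ∫⁻ z in Metric.ball w r,
      ENNReal.ofReal (((m : ℝ) + 1) ^ 2 / Real.pi * Real.exp (-(((m : ℝ) + 1) ^ 2 * ‖z - w‖ ^ 2))))
      atTop (𝓝 1) := by
  have hpi := Real.pi_pos
  set φ : ℂ → ℝ := fun x => Real.pi⁻¹ * Real.exp (-1 * ‖x‖ ^ 2) with hφ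
  have h1 : ∫ x, φ x = 1 := by
    rw [hφ, integral_const_mul, GaussianFourier.integral_rexp_neg_mul_sq_norm one_pos]
    simp [Complex.finrank_real_complex]
  have h2 : Tendsto (fun x : ℂ => ‖x‖ ^ Module.finrank ℝ ℂ * φ x) (Bornology.cobounded ℂ) (𝓝 0) := by
    rw [Complex.finrank_real_complex]
    have h := (Real.tendsto_pow_mul_exp_neg_atTop_nhds_zero 1).comp
      ((tendsto_pow_atTop (two_ne_zero)).comp (tendsto_norm_cobounded_atTop (E := ℂ)))
    have h' := h.const_mul Real.pi⁻¹
    rw [mul_zero] at h'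
    refine h'.congr fun x => ?_
    simp only [Function.comp, hφ]
    ring_nf
  have hg : Integrable ((Metric.ball w r).indicator fun _ => (1 : ℝ)) :=
    (integrable_indicator_iff Metric.isOpen_ball.measurableSet).2
      (integrableOn_const Metric.isBounded_ball.measure_lt_top.ne)
  have hgc : ContinuousAt ((Metric.ball w r).indicator fun _ => (1 : ℝ)) w := by
    refine (continuousAt_const (y := (1 : ℝ))).congr ?_
    filter_upwards [Metric.ball_mem_nhds w hr] with z hz
    rw [indicator_of_mem hz]
  have h3 := tendsto_integral_comp_smul_smul_of_integrable' (μ := (volume : Measure ℂ))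
    (fun x => by simp only [hφ]; positivity) h1 h2 hg hgc
  rw [indicator_of_mem (Metric.mem_ball_self hr), Complex.finrank_real_complex] at h3
  have h4 := ENNReal.tendsto_ofReal (h3.comp
    (tendsto_atTop_add_const_right atTop (1 : ℝ) tendsto_natCast_atTop_atTop))
  rw [ENNReal.ofReal_one] at h4
  refine h4.congr fun m => ?_
  simp only [Function.comp]
  have e : (fun z => (((m : ℝ) + 1) ^ 2 * φ (((m : ℝ) + 1) • (w - z))) •
      (Metric.ball w r).indicator (fun _ => (1 : ℝ)) z) =
      (Metric.ball w r).indicator fun z =>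
        ((m : ℝ) + 1) ^ 2 / Real.pi * Real.exp (-(((m : ℝ) + 1) ^ 2 * ‖z - w‖ ^ 2)) := by
    ext z
    by_cases hz : z ∈ Metric.ball w r
    · rw [indicator_of_mem hz, indicator_of_mem hz, smul_eq_mul, mul_one]
      simp only [hφ]
      rw [norm_smul, norm_sub_rev, mul_pow, Real.norm_eq_abs, sq_abs, neg_one_mul]
      ring
    · rw [indicator_of_notMem hz, indicator_of_notMem hz, smul_zero]
  rw [e, integral_indicator Metric.isOpen_ball.measurableSet, ofReal_integral_eq_lintegral_ofReal]
  · have hcont : Continuous fun z : ℂ => ((m : ℝ) + 1) ^ 2 / Real.pi *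
        Real.exp (-(((m : ℝ) + 1) ^ 2 * ‖z - w‖ ^ 2)) := by fun_prop
    exact (hcont.continuousOn.integrableOn_compact (isCompact_closedBall w r)).mono_set
      Metric.ball_subset_closedBall
  · exact Eventually.of_forall fun z => by simp only [Pi.zero_apply]; positivity

/-- The bound for the density of the value distribution of the linear form. -/
noncomputable def densityBound {n : ℕ} (D : Fin (n + 1) → ℂ) (r : ℝ) : ℝ≥0∞ :=
  ENNReal.ofReal (1 / (2 * Real.pi) * (max 1 (c D / r)) ^ (1 / 2 : ℝ)) * besselProductIntegral D

theorem measurable_densityBound {n : ℕ} (D : Fin (n + 1) → ℂ) : Measurable (densityBound D) := by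
  unfold densityBound; fun_prop

/-- The Gaussian mass on O tends to 1 at each point of O. Fatou's lemma thus bounds the measure of O
by averages of that mass, and these are bounded by exchanging integrals and using the smoothed
density estimate. Openness of O is what gives every point of O a ball inside it. -/
theorem map_torusValue_open_le {n : ℕ} (D : Fin (n + 1) → ℂ) (hc : 0 < c D) {O : Set ℂ}
    (hO : IsOpen O) :
    (torusMeasure (Fin (n + 1))).map (torusValue D) O ≤ ∫⁻ z in O, densityBound D ‖z‖ := by
  have hpi := Real.pi_pos
  have hcv := continuous_torusValue D
  set p : ℕ → ℂ → ℝ≥0∞ := fun m w => ∫⁻ z in O,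
      ENNReal.ofReal (((m : ℝ) + 1) ^ 2 / Real.pi * Real.exp (-(((m : ℝ) + 1) ^ 2 * ‖z - w‖ ^ 2)))
    with hp
  have hone : ∀ w ∈ O, 1 ≤ liminf (fun m => p m w) atTop := by
    intro w hw
    obtain ⟨r, hr, hball⟩ := Metric.isOpen_iff.1 hO w hw
    rw [← (tendsto_lintegral_gaussian_ball w hr).liminf_eq]
    exact liminf_le_liminf (Eventually.of_forall fun m => lintegral_mono_set hball)
  have hmeas : ∀ m, Measurable (p m) := by
    intro m
    refine Measurable.lintegral_prod_right' (f := fun q : ℂ × ℂ =>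
      ENNReal.ofReal (((m : ℝ) + 1) ^ 2 / Real.pi *
        Real.exp (-(((m : ℝ) + 1) ^ 2 * ‖q.2 - q.1‖ ^ 2)))) (by fun_prop)
  have hbound : ∀ m, ∫⁻ θ, p m (torusValue D θ) ∂torusMeasure (Fin (n + 1)) ≤
      ∫⁻ z in O, densityBound D ‖z‖ := by
    intro m
    simp only [hp]
    rw [lintegral_lintegral_swap (by
      have h1 : Continuous fun q : (Fin (n + 1) → ℝ) × ℂ => torusValue D q.1 :=
        hcv.comp continuous_fst
      refine Continuous.aemeasurable (ENNReal.continuous_ofReal.comp ?_)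
      fun_prop)]
    have h0 : ∀ᵐ z ∂(volume.restrict O : Measure ℂ), z ≠ 0 :=
      ae_restrict_of_ae (by simp [ae_iff])
    refine lintegral_mono_ae (h0.mono fun z hz => ?_)
    have hb : 0 < ((m : ℝ) + 1) ^ 2 := by positivity
    have h := ofReal_integral_gaussian_le D hc hz hb
    rw [← ofReal_integral_eq_lintegral_ofReal]
    · have e : ∫ θ, ((m : ℝ) + 1) ^ 2 / Real.pi *
          Real.exp (-(((m : ℝ) + 1) ^ 2 * ‖z - torusValue D θ‖ ^ 2)) ∂torusMeasure (Fin (n + 1)) =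
          1 / (2 * Real.pi) * ∫ θ, 2 * ((m : ℝ) + 1) ^ 2 *
            Real.exp (-(((m : ℝ) + 1) ^ 2 * ‖z - torusValue D θ‖ ^ 2))
              ∂torusMeasure (Fin (n + 1)) := by
        rw [← integral_const_mul]
        congr 1
        ext θ
        field_simp
      rw [e, densityBound, ENNReal.ofReal_mul (by positivity), ENNReal.ofReal_mul (by positivity),
        mul_assoc]
      gcongr
    · refine Integrable.of_bound (C := ((m : ℝ) + 1) ^ 2 / Real.pi)
        (Continuous.aestronglyMeasurable (by fun_prop)) (Eventually.of_forall fun θ => ?_)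
      rw [Real.norm_eq_abs, abs_of_nonneg (by positivity)]
      refine mul_le_of_le_one_right (by positivity) ?_
      rw [Real.exp_le_one_iff, neg_nonpos]
      positivity
    · exact Eventually.of_forall fun z => by simp only [Pi.zero_apply]; positivity
  rw [Measure.map_apply hcv.measurable hO.measurableSet,
    ← lintegral_indicator_one (hcv.measurable hO.measurableSet)]
  calc ∫⁻ θ, (torusValue D ⁻¹' O).indicator 1 θ ∂torusMeasure (Fin (n + 1))
      ≤ ∫⁻ θ, liminf (fun m => p m (torusValue D θ)) atTop ∂torusMeasure (Fin (n + 1)) := by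
        refine lintegral_mono fun θ => ?_
        by_cases hθ : θ ∈ torusValue D ⁻¹' O
        · rw [indicator_of_mem hθ]
          exact hone _ hθ
        · rw [indicator_of_notMem hθ]
          exact zero_le
    _ ≤ liminf (fun m => ∫⁻ θ, p m (torusValue D θ) ∂torusMeasure (Fin (n + 1))) atTop :=
        lintegral_liminf_le fun m => (hmeas m).comp hcv.measurable
    _ ≤ _ := by
        refine (liminf_le_liminf (Eventually.of_forall hbound)).trans_eq ?_
        simp

/-- Local finiteness gives outer regularity of the dominating measure, which is needed to pass from
open sets to Borel sets. The singularity r^(-1/2) at the origin is absorbed by the polar Jacobian r.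
-/
theorem lintegral_densityBound_ball_lt_top {n : ℕ} (D : Fin (n + 1) → ℂ)
    (hI : besselProductIntegral D ≠ ∞) (R : ℝ) :
    ∫⁻ z in Metric.ball (0 : ℂ) R, densityBound D ‖z‖ < ∞ := by
  have hpi := Real.pi_pos
  have e : ∀ z : ℂ, (Metric.ball (0 : ℂ) R).indicator (fun z => densityBound D ‖z‖) z =
      (fun r => (Iio R).indicator (densityBound D) r) ‖z‖ := by
    intro z
    simp only [indicator, Metric.mem_ball, dist_zero_right, mem_Iio]
  rw [← lintegral_indicator Metric.isOpen_ball.measurableSet, lintegral_congr e,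
    lintegral_comp_norm_complex ((measurable_densityBound D).indicator measurableSet_Iio)]
  refine ENNReal.mul_lt_top ENNReal.ofReal_lt_top ?_
  have hc0 : 0 ≤ c D := Real.sqrt_nonneg _
  have hle : ∀ r ∈ Ioi (0 : ℝ), ENNReal.ofReal r * (Iio R).indicator (densityBound D) r ≤
      (Iio R).indicator (fun _ => ENNReal.ofReal (1 / (2 * Real.pi) * (R + c D)) *
        besselProductIntegral D) r := by
    intro r hr
    have hr0 : (0 : ℝ) < r := hr
    by_cases hrR : r ∈ Iio R
    · rw [indicator_of_mem hrR, indicator_of_mem hrR, densityBound, ← mul_assoc,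
        ← ENNReal.ofReal_mul hr0.le]
      gcongr ENNReal.ofReal ?_ * _
      have hM : 1 ≤ max 1 (c D / r) := le_max_left _ _
      have h1 : (max 1 (c D / r)) ^ (1 / 2 : ℝ) ≤ 1 + c D / r :=
        (Real.rpow_le_self_of_one_le hM (by norm_num)).trans
          (max_le (by linarith [div_nonneg hc0 hr0.le]) (by linarith))
      have h2 : r * (1 + c D / r) ≤ R + c D := by
        rw [mul_add, mul_div_cancel₀ _ hr0.ne', mul_one]
        have : r < R := hrR
        linarith
      calc r * (1 / (2 * Real.pi) * max 1 (c D / r) ^ (1 / 2 : ℝ))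
          ≤ r * (1 / (2 * Real.pi) * (1 + c D / r)) := by gcongr
        _ = 1 / (2 * Real.pi) * (r * (1 + c D / r)) := by ring
        _ ≤ _ := by gcongr
    · rw [indicator_of_notMem hrR, mul_zero]
      exact zero_le
  refine (setLIntegral_mono' measurableSet_Ioi hle).trans_lt ?_
  rw [lintegral_indicator measurableSet_Iio, setLIntegral_const,
    Measure.restrict_apply measurableSet_Iio, Iio_inter_Ioi, Real.volume_Ioo]
  exact ENNReal.mul_lt_top (ENNReal.mul_lt_top ENNReal.ofReal_lt_top hI.lt_top)
    ENNReal.ofReal_lt_top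

theorem map_torusValue_le {n : ℕ} (D : Fin (n + 1) → ℂ) (hc : 0 < c D)
    (hI : besselProductIntegral D ≠ ∞) :
    (torusMeasure (Fin (n + 1))).map (torusValue D) ≤
      (volume : Measure ℂ).withDensity fun z => densityBound D ‖z‖ := by
  set ρ := (volume : Measure ℂ).withDensity fun z => densityBound D ‖z‖ with hρ
  have hlf : IsLocallyFiniteMeasure ρ := by
    refine ⟨fun z => ⟨Metric.ball 0 (‖z‖ + 1), Metric.isOpen_ball.mem_nhds (by simp), ?_⟩⟩
    rw [hρ, withDensity_apply _ Metric.isOpen_ball.measurableSet]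
    exact lintegral_densityBound_ball_lt_top D hI _
  refine Measure.le_iff.2 fun A hA => ?_
  rw [A.measure_eq_iInf_isOpen ρ]
  refine le_iInf₂ fun U hAU => le_iInf fun hU => (measure_mono hAU).trans ?_
  rw [hρ, withDensity_apply _ hU.measurableSet]
  exact map_torusValue_open_le D hc hU

theorem G_eq {n : ℕ} (D : Fin (n + 1) → ℂ) :
    G D = ENNReal.ofReal (c D ^ 2) * besselProductIntegral D := rfl

/-- The law of `U = |P_D|² / c(D)²` has a density bounded by `(G / 2) v^(-1/4)` on `(0, 1]`. -/
theorem lintegral_normSq_torusValue_le {n : ℕ} (D : Fin (n + 1) → ℂ) (hc : 0 < c D)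
    (hG : G D ≠ ∞) {h : ℝ → ℝ≥0∞} (hh : Measurable h) :
    ∫⁻ θ, h (‖torusValue D θ‖ ^ 2 / c D ^ 2) ∂torusMeasure (Fin (n + 1)) ≤
      G D / 2 * ∫⁻ v in Ioc (0 : ℝ) 1, ENNReal.ofReal (v ^ (-(1 / 4) : ℝ)) * h v := by
  have hpi := Real.pi_pos
  have hcv := continuous_torusValue D
  have hI : besselProductIntegral D ≠ ∞ := by
    intro hcon
    rw [G_eq, hcon, ENNReal.mul_top] at hG
    · exact hG rfl
    · exact (ENNReal.ofReal_pos.2 (by positivity)).ne'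
  -- Truncation costs nothing, since |P_D| ≤ c(D), and on r ≤ c(D) the maximum max{1, c(D)/r} is
  -- simply c(D)/r.
  set g : ℝ → ℝ≥0∞ := (Iic (c D)).indicator fun r => h (r ^ 2 / c D ^ 2) with hg
  have hgm : Measurable g := Measurable.indicator (by fun_prop) measurableSet_Iic
  have hstep : ∫⁻ θ, h (‖torusValue D θ‖ ^ 2 / c D ^ 2) ∂torusMeasure (Fin (n + 1)) =
      ∫⁻ z, g ‖z‖ ∂(torusMeasure (Fin (n + 1))).map (torusValue D) := by
    rw [lintegral_map (by fun_prop) hcv.measurable]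
    refine lintegral_congr fun θ => ?_
    rw [hg, indicator_of_mem (show ‖torusValue D θ‖ ∈ Iic (c D) from norm_torusValue_le D θ)]
  rw [hstep]
  refine (lintegral_mono' (map_torusValue_le D hc hI) le_rfl).trans ?_
  rw [lintegral_withDensity_eq_lintegral_mul _
    (f := fun z : ℂ => densityBound D ‖z‖) ((measurable_densityBound D).comp measurable_norm)
    (g := fun z : ℂ => g ‖z‖) (hgm.comp measurable_norm)]
  simp only [Pi.mul_apply]
  rw [lintegral_comp_norm_complex (f := fun r => densityBound D r * g r)
    ((measurable_densityBound D).mul hgm)]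
  have hsub := lintegral_image_eq_lintegral_abs_deriv_mul (s := Ioc 0 (c D))
    (f := fun r => r ^ 2 / c D ^ 2) (f' := fun r => 2 * r / c D ^ 2) measurableSet_Ioc
    (fun r _ => by
      have := ((hasDerivAt_pow 2 r).div_const (c D ^ 2)).hasDerivWithinAt (s := Ioc 0 (c D))
      simpa using this)
    (fun a ha b hb hab => by
      have : a ^ 2 = b ^ 2 := by
        simp only at hab
        field_simp at hab
        exact hab
      exact (sq_eq_sq₀ ha.1.le hb.1.le).1 this)
    (fun v => ENNReal.ofReal (v ^ (-(1 / 4) : ℝ)) * h v)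
  have himg : (fun r => r ^ 2 / c D ^ 2) '' Ioc 0 (c D) = Ioc (0 : ℝ) 1 := by
    ext v
    constructor
    · rintro ⟨r, ⟨hr0, hr1⟩, rfl⟩
      refine ⟨by positivity, ?_⟩
      rw [div_le_one (by positivity)]
      gcongr
    · rintro ⟨hv0, hv1⟩
      refine ⟨c D * Real.sqrt v, ⟨by positivity, ?_⟩, ?_⟩
      · exact mul_le_of_le_one_right hc.le (Real.sqrt_le_one.2 hv1)
      · simp only [mul_pow, Real.sq_sqrt hv0.le]
        field_simp
  rw [himg] at hsub
  rw [hsub, ← lintegral_const_mul' _ _ ENNReal.ofReal_ne_top,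
    ← lintegral_const_mul' _ _ (ENNReal.div_ne_top hG two_ne_zero)]
  have hind : ∀ r ∈ Ioi (0 : ℝ), ENNReal.ofReal (2 * Real.pi) *
      (ENNReal.ofReal r * (densityBound D r * g r)) =
      (Iic (c D)).indicator (fun r => G D / 2 * (ENNReal.ofReal |2 * r / c D ^ 2| *
        (ENNReal.ofReal ((r ^ 2 / c D ^ 2) ^ (-(1 / 4) : ℝ)) * h (r ^ 2 / c D ^ 2)))) r := by
    intro r hr
    have hr0 : (0 : ℝ) < r := hr
    by_cases hrc : r ∈ Iic (c D)
    · rw [hg, indicator_of_mem hrc, indicator_of_mem hrc, densityBound, G_eq]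
      have hrc' : 1 ≤ c D / r := (one_le_div hr0).2 hrc
      rw [max_eq_right hrc', abs_of_nonneg (by positivity)]
      -- With v = r²/c², r (c/r)^(1/2) dr = (c²/2) v^(-1/4) dv: the source of the exponent -1/4 and
      -- of the factor G/2.
      have key : 2 * Real.pi * (r * (1 / (2 * Real.pi) * (c D / r) ^ (1 / 2 : ℝ))) =
          c D ^ 2 * (1 / 2) * (2 * r / c D ^ 2 * (r ^ 2 / c D ^ 2) ^ (-(1 / 4) : ℝ)) := by
        have e : (r ^ 2 / c D ^ 2) ^ (-(1 / 4) : ℝ) = (c D / r) ^ (1 / 2 : ℝ) := by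
          rw [Real.rpow_neg (by positivity), ← Real.inv_rpow (by positivity), inv_div, ← div_pow,
            ← Real.rpow_natCast, ← Real.rpow_mul (by positivity)]
          norm_num
        rw [e]
        field_simp
      have h2 : (2 : ℝ≥0∞)⁻¹ = ENNReal.ofReal (1 / 2) := by
        rw [one_div, ENNReal.ofReal_inv_of_pos two_pos]; norm_num
      rw [div_eq_mul_inv (_ : ℝ≥0∞) 2, h2]
      calc ENNReal.ofReal (2 * Real.pi) * (ENNReal.ofReal r *
            (ENNReal.ofReal (1 / (2 * Real.pi) * (c D / r) ^ (1 / 2 : ℝ)) *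
              besselProductIntegral D * h (r ^ 2 / c D ^ 2)))
          = (ENNReal.ofReal (2 * Real.pi) * (ENNReal.ofReal r *
            ENNReal.ofReal (1 / (2 * Real.pi) * (c D / r) ^ (1 / 2 : ℝ)))) *
              besselProductIntegral D * h (r ^ 2 / c D ^ 2) := by ring
        _ = (ENNReal.ofReal (c D ^ 2) * ENNReal.ofReal (1 / 2) *
              (ENNReal.ofReal (2 * r / c D ^ 2) *
                ENNReal.ofReal ((r ^ 2 / c D ^ 2) ^ (-(1 / 4) : ℝ)))) *
              besselProductIntegral D * h (r ^ 2 / c D ^ 2) := by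
            rw [← ENNReal.ofReal_mul hr0.le, ← ENNReal.ofReal_mul (by positivity), key,
              ENNReal.ofReal_mul (by positivity), ENNReal.ofReal_mul (by positivity),
              ENNReal.ofReal_mul (by positivity)]
        _ = _ := by ring
    · rw [hg, indicator_of_notMem hrc, indicator_of_notMem hrc, mul_zero, mul_zero, mul_zero]
  rw [setLIntegral_congr_fun measurableSet_Ioi hind, lintegral_indicator measurableSet_Iic,
    Measure.restrict_restrict measurableSet_Iic, Iic_inter_Ioi]

/-! ### Mahler measure and even moments as torus integrals. -/

theorem torusMeasure_eq_smul_restrict (d : ℕ) :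
    torusMeasure (Fin d) = ENNReal.ofReal (1 / (2 * Real.pi) ^ d) •
      volume.restrict (Icc (0 : Fin d → ℝ) fun _ => 2 * Real.pi) := by
  have hpi := Real.pi_pos
  refine Measure.pi_eq fun s hs => ?_
  have hIcc : Icc (0 : Fin d → ℝ) (fun _ => 2 * Real.pi) =
      Set.pi univ fun _ => Icc 0 (2 * Real.pi) := (pi_univ_Icc _ _).symm
  rw [Measure.smul_apply, Measure.restrict_apply (MeasurableSet.univ_pi hs), hIcc, ← pi_inter_distrib,
    volume_pi_pi, smul_eq_mul]
  have : ∀ i, angleMeasure (s i) =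
      ENNReal.ofReal (1 / (2 * Real.pi)) * volume (s i ∩ Icc 0 (2 * Real.pi)) := by
    intro i
    rw [angleMeasure, Measure.restrict_congr_set Ioc_ae_eq_Icc, Measure.smul_apply,
      Measure.restrict_apply (hs i), smul_eq_mul]
  simp_rw [this, Finset.prod_mul_distrib, Finset.prod_const, Finset.card_univ, Fintype.card_fin]
  rw [← ENNReal.ofReal_pow (by positivity), one_div_pow]

theorem logMahlerMeasure_linearForm {n : ℕ} (D : Fin (n + 1) → ℂ) :
    logMahlerMeasure (linearForm D) =
      ∫ θ, Real.log ‖torusValue D θ‖ ∂torusMeasure (Fin (n + 1)) := by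
  have hpi := Real.pi_pos
  rw [logMahlerMeasure, mahlerMeasure, Real.log_exp, torusMeasure_eq_smul_restrict,
    integral_smul_measure, ENNReal.toReal_ofReal (by positivity), smul_eq_mul]
  simp [linearForm, torusValue]

theorem integral_exp_int_mul {m : ℤ} (hm : m ≠ 0) :
    ∫ θ : ℝ, Complex.exp (m * (Complex.I * θ)) ∂angleMeasure = 0 := by
  have hc : (m : ℂ) * Complex.I ≠ 0 := mul_ne_zero (by exact_mod_cast hm) Complex.I_ne_zero
  rw [integral_angleMeasure]
  simp_rw [← mul_assoc]
  rw [integral_exp_mul_complex hc]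
  have : (m : ℂ) * Complex.I * ((2 * Real.pi : ℝ) : ℂ) = m * (2 * Real.pi * Complex.I) := by
    push_cast; ring
  rw [this, Complex.exp_int_mul_two_pi_mul_I]
  simp

theorem integral_pow_mul_conj_pow (w : ℂ) (p q : ℕ) :
    ∫ θ : ℝ, (w * Complex.exp (Complex.I * θ)) ^ p *
      (starRingEnd ℂ) ((w * Complex.exp (Complex.I * θ)) ^ q) ∂angleMeasure =
      if p = q then ((‖w‖ ^ (2 * p) : ℝ) : ℂ) else 0 := by
  split_ifs with h
  · subst h
    have : ∀ θ : ℝ, (w * Complex.exp (Complex.I * θ)) ^ p *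
        (starRingEnd ℂ) ((w * Complex.exp (Complex.I * θ)) ^ p) = ((‖w‖ ^ (2 * p) : ℝ) : ℂ) := by
      intro θ
      rw [Complex.mul_conj, Complex.normSq_eq_norm_sq, norm_pow, norm_mul, mul_comm Complex.I,
        Complex.norm_exp_ofReal_mul_I, mul_one, ← pow_mul, mul_comm p]
    simp_rw [this]
    simp
  · have : ∀ θ : ℝ, (w * Complex.exp (Complex.I * θ)) ^ p *
        (starRingEnd ℂ) ((w * Complex.exp (Complex.I * θ)) ^ q) =
        w ^ p * (starRingEnd ℂ) w ^ q *
          Complex.exp (((p - q : ℤ) : ℂ) * (Complex.I * θ)) := by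
      intro θ
      rw [map_pow, map_mul, ← Complex.exp_conj, mul_pow, mul_pow, ← Complex.exp_nat_mul,
        ← Complex.exp_nat_mul, mul_mul_mul_comm, ← Complex.exp_add]
      congr 2
      simp
      ring
    simp_rw [this]
    rw [integral_const_mul, integral_exp_int_mul (by omega), mul_zero]

/-- The even moments of `|P_D|` on the torus. -/
theorem integral_norm_torusValue_pow {n : ℕ} (D : Fin (n + 1) → ℂ) (k : ℕ) :
    ∫ θ, ‖torusValue D θ‖ ^ (2 * k) ∂torusMeasure (Fin (n + 1)) = a k D := by
  set S := Finset.piAntidiag (Finset.univ : Finset (Fin (n + 1))) k with hS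
  set F : (Fin (n + 1) → ℕ) → (Fin (n + 1) → ℕ) → (Fin (n + 1) → ℝ) → ℂ := fun l l' θ =>
    ∏ i, ((D i * Complex.exp (Complex.I * θ i)) ^ l i *
      (starRingEnd ℂ) ((D i * Complex.exp (Complex.I * θ i)) ^ l' i)) with hF
  have hpow : ∀ θ, torusValue D θ ^ k = ∑ l ∈ S, (Nat.multinomial Finset.univ l : ℂ) *
      ∏ i, (D i * Complex.exp (Complex.I * θ i)) ^ l i := fun θ =>
    Finset.sum_pow_eq_sum_piAntidiag _ _ _
  have hexp : ∀ θ, ((‖torusValue D θ‖ ^ (2 * k) : ℝ) : ℂ) =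
      ∑ l ∈ S, ∑ l' ∈ S, ((Nat.multinomial Finset.univ l : ℂ) * Nat.multinomial Finset.univ l') *
        F l l' θ := by
    intro θ
    have : ((‖torusValue D θ‖ ^ (2 * k) : ℝ) : ℂ) =
        torusValue D θ ^ k * (starRingEnd ℂ) (torusValue D θ ^ k) := by
      rw [Complex.mul_conj, Complex.normSq_eq_norm_sq, norm_pow, ← pow_mul, mul_comm k]
    rw [this, hpow, map_sum, Finset.sum_mul_sum]
    refine Finset.sum_congr rfl fun l _ => Finset.sum_congr rfl fun l' _ => ?_
    rw [map_mul, map_prod, hF]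
    simp only [Finset.prod_mul_distrib, Complex.conj_natCast]
    ring
  have hFc : ∀ l l', Continuous (F l l') := fun l l' => by
    simp only [hF]
    fun_prop
  have hFi : ∀ l l', Integrable (F l l') (torusMeasure (Fin (n + 1))) := by
    intro l l'
    rw [torusMeasure_eq_smul_restrict]
    exact ((hFc l l').integrableOn_Icc).smul_measure ENNReal.ofReal_ne_top
  -- Orthogonality of characters leaves only the diagonal, which explains the squared multinomial
  -- coefficients.
  have hFint : ∀ l l', ∫ θ, F l l' θ ∂torusMeasure (Fin (n + 1)) =
      if l = l' then ((∏ i, ‖D i‖ ^ (2 * l i) : ℝ) : ℂ) else 0 := by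
    intro l l'
    simp only [hF]
    rw [torusMeasure, integral_fintype_prod_eq_prod (f := fun i (x : ℝ) =>
      (D i * Complex.exp (Complex.I * x)) ^ l i *
      (starRingEnd ℂ) ((D i * Complex.exp (Complex.I * x)) ^ l' i))]
    simp_rw [integral_pow_mul_conj_pow]
    split_ifs with h
    · subst h
      simp
    · obtain ⟨i, hi⟩ := Function.ne_iff.1 h
      exact Finset.prod_eq_zero (Finset.mem_univ i) (if_neg hi)
  rw [← Complex.ofReal_inj, ← integral_complex_ofReal]
  simp_rw [hexp]
  rw [integral_finsetSum _ fun l _ => integrable_finsetSum _ fun l' _ => (hFi l l').const_mul _]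
  rw [a, Complex.ofReal_sum]
  refine Finset.sum_congr rfl fun l hl => ?_
  rw [integral_finsetSum _ fun l' _ => (hFi l l').const_mul _]
  simp_rw [integral_const_mul, hFint]
  rw [Finset.sum_eq_single l]
  · rw [if_pos rfl]
    push_cast
    ring
  · intro l' _ hne
    rw [if_neg (Ne.symm hne), mul_zero]
  · exact fun h => absurd hl h

/-! ### The Taylor remainder of the logarithm. -/

/-- Writing v^s log v = s⁻¹ v^s log(v^s) reduces to the continuity of x log x; at 0 both sides
vanish because `Real.log 0 = 0`. -/
theorem continuousOn_rpow_mul_log {s : ℝ} (hs : 0 < s) :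
    ContinuousOn (fun v : ℝ => v ^ s * Real.log v) (Ici 0) := by
  have h : Continuous fun v : ℝ => s⁻¹ * (v ^ s * Real.log (v ^ s)) :=
    (Real.continuous_mul_log.comp (Real.continuous_rpow_const hs.le)).const_mul _
  refine h.continuousOn.congr fun v hv => ?_
  rcases (show (0 : ℝ) ≤ v from hv).eq_or_lt with h0 | h0
  · simp [← h0, Real.zero_rpow hs.ne']
  · simp only [Real.log_rpow h0]
    field_simp

/-- Split the exponent evenly: v^((s-1)/2) is still integrable, and v^((s+1)/2) log v is continuous
up to 0. -/
theorem intervalIntegrable_rpow_mul_log {s : ℝ} (hs : -1 < s) :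
    IntervalIntegrable (fun v : ℝ => v ^ s * Real.log v) volume 0 1 := by
  have hd : 0 < (s + 1) / 2 := by linarith
  have h1 : IntervalIntegrable (fun v : ℝ => v ^ ((s - 1) / 2)) volume 0 1 :=
    intervalIntegral.intervalIntegrable_rpow' (by linarith)
  have h2 := h1.mul_continuousOn (g := fun v : ℝ => v ^ ((s + 1) / 2) * Real.log v)
    ((continuousOn_rpow_mul_log hd).mono (by
      rw [uIcc_of_le zero_le_one]; exact Icc_subset_Ici_self))
  refine h2.congr_ae ?_
  rw [uIoc_of_le zero_le_one]
  refine (ae_restrict_iff' measurableSet_Ioc).2 (Eventually.of_forall fun v hv => ?_)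
  simp only
  rw [← mul_assoc, ← Real.rpow_add hv.1]
  congr 2
  ring

/-- The tail of the Taylor series of `-log v` at `v = 1`. -/
noncomputable def logTail (N : ℕ) (v : ℝ) : ℝ :=
  -Real.log v - ∑ j ∈ Finset.Icc 1 N, 1 / (j : ℝ) * (1 - v) ^ j

/-- Differentiating the sum gives a geometric series, which collapses against -1/v. -/
theorem hasDerivAt_logTail (N : ℕ) {v : ℝ} (hv : 0 < v) :
    HasDerivAt (logTail N) (-((1 - v) ^ N / v)) v := by
  induction N with
  | zero =>
    have : logTail 0 = fun v => -Real.log v := by ext v; simp [logTail]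
    rw [this]
    exact (Real.hasDerivAt_log hv.ne').neg.congr_deriv (by simp)
  | succ N ih =>
    have : logTail (N + 1) = fun v => logTail N v - 1 / ((N + 1 : ℕ) : ℝ) * (1 - v) ^ (N + 1) := by
      ext v
      rw [logTail, logTail, Finset.sum_Icc_succ_top (by omega)]
      ring
    rw [this]
    have h := ih.sub ((((hasDerivAt_id v).const_sub 1).pow (N + 1)).const_mul
      (1 / ((N + 1 : ℕ) : ℝ)))
    refine h.congr_deriv ?_
    have : ((N : ℝ) + 1) ≠ 0 := by positivity
    simp only [id, Nat.add_sub_cancel]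
    push_cast
    field_simp
    ring

/-- The derivative is nonpositive and the value at 1 is 0. The sign later removes the absolute
value, allowing integration by parts. -/
theorem logTail_nonneg (N : ℕ) {v : ℝ} (hv0 : 0 < v) (hv1 : v ≤ 1) : 0 ≤ logTail N v := by
  have hanti : AntitoneOn (logTail N) (Icc v 1) := by
    refine antitoneOn_of_deriv_nonpos (convex_Icc v 1) ?_ ?_ ?_
    · exact fun x hx => (hasDerivAt_logTail N (hv0.trans_le hx.1)).continuousAt.continuousWithinAt
    · rw [interior_Icc]
      exact fun x hx => (hasDerivAt_logTail N
        (hv0.trans hx.1)).differentiableAt.differentiableWithinAt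
    · rw [interior_Icc]
      intro x hx
      rw [(hasDerivAt_logTail N (hv0.trans hx.1)).deriv, neg_nonpos]
      exact div_nonneg (pow_nonneg (by linarith [hx.2]) _) (hv0.trans hx.1).le
  have := hanti (left_mem_Icc.2 hv1) (right_mem_Icc.2 hv1) hv1
  refine le_trans ?_ this
  rw [logTail, Real.log_one, Finset.sum_eq_zero]
  · simp
  · intro j hj
    rw [sub_self, zero_pow (by have := (Finset.mem_Icc.1 hj).1; omega), mul_zero]

theorem intervalIntegrable_rpow_mul_logTail (N : ℕ) :
    IntervalIntegrable (fun v : ℝ => v ^ (-(1 / 4) : ℝ) * logTail N v) volume 0 1 := by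
  have h1 : IntervalIntegrable (fun v : ℝ => v ^ (-(1 / 4) : ℝ)) volume 0 1 :=
    intervalIntegral.intervalIntegrable_rpow' (by norm_num)
  have h2 := h1.mul_continuousOn
    (g := fun v : ℝ => ∑ j ∈ Finset.Icc 1 N, 1 / (j : ℝ) * (1 - v) ^ j)
    (Continuous.continuousOn (by fun_prop))
  have h3 := (intervalIntegrable_rpow_mul_log (s := -(1 / 4)) (by norm_num)).neg.sub h2
  refine h3.congr fun v _ => ?_
  simp only [Pi.neg_apply, logTail]
  ring

/-- Integrating v^(-1/4) by parts, without boundary terms, replaces the tail by (4/3) v^(-1/4)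
(1-v)^N. Then 1 - v ≤ e^{-v} and extending to (0, ∞) give the Gamma integral. -/
theorem integral_rpow_mul_logTail_le {N : ℕ} (hN : 1 ≤ N) :
    ∫ v in (0 : ℝ)..1, v ^ (-(1 / 4) : ℝ) * logTail N v ≤
      4 / 3 * (Real.Gamma (3 / 4) / (N : ℝ) ^ (3 / 4 : ℝ)) := by
  have hN0 : (0 : ℝ) < N := by exact_mod_cast hN
  have hi1 := intervalIntegrable_rpow_mul_logTail N
  have hi2 : IntervalIntegrable (fun v : ℝ => v ^ (-(1 / 4) : ℝ) * (1 - v) ^ N) volume 0 1 :=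
    (intervalIntegral.intervalIntegrable_rpow' (by norm_num)).mul_continuousOn
      (Continuous.continuousOn (by fun_prop))
  have hparts : ∫ v in (0 : ℝ)..1, (v ^ (-(1 / 4) : ℝ) * logTail N v -
      4 / 3 * (v ^ (-(1 / 4) : ℝ) * (1 - v) ^ N)) = 0 := by
    rw [intervalIntegral.integral_eq_sub_of_hasDerivAt_of_le zero_le_one
      (f := fun v => 4 / 3 * (v ^ (3 / 4 : ℝ) * logTail N v)) ?_ ?_ (hi1.sub (hi2.const_mul _))]
    · have : logTail N 1 = 0 := by
        rw [logTail, Real.log_one, Finset.sum_eq_zero]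
        · simp
        · intro j hj
          rw [sub_self, zero_pow (by have := (Finset.mem_Icc.1 hj).1; omega), mul_zero]
      rw [this, Real.zero_rpow (by norm_num)]
      simp
    · have h1 : ContinuousOn (fun v : ℝ => v ^ (3 / 4 : ℝ) * Real.log v) (Icc 0 1) :=
        (continuousOn_rpow_mul_log (by norm_num)).mono Icc_subset_Ici_self
      have h2 : Continuous fun v : ℝ => v ^ (3 / 4 : ℝ) :=
        Real.continuous_rpow_const (by norm_num)
      have h3 : Continuous fun v : ℝ => v ^ (3 / 4 : ℝ) *
        ∑ j ∈ Finset.Icc 1 N, 1 / (j : ℝ) * (1 - v) ^ j := by fun_prop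
      refine ((h1.neg.sub h3.continuousOn).const_mul (4 / 3)).congr fun v _ => ?_
      simp only [Pi.sub_apply, Pi.neg_apply, logTail]
      ring
    · intro v hv
      have h := ((Real.hasDerivAt_rpow_const (x := v) (p := 3 / 4) (Or.inl hv.1.ne')).mul
        (hasDerivAt_logTail N hv.1)).const_mul (4 / 3)
      refine h.congr_deriv ?_
      have e : v ^ (3 / 4 : ℝ) = v * v ^ (-(1 / 4) : ℝ) := by
        rw [← Real.rpow_one_add' hv.1.le (by norm_num)]; norm_num
      rw [e, show (3 / 4 : ℝ) - 1 = -(1 / 4) by norm_num]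
      have := hv.1.ne'
      field_simp
      ring
  rw [intervalIntegral.integral_sub hi1 (hi2.const_mul _), intervalIntegral.integral_const_mul,
    sub_eq_zero] at hparts
  rw [hparts]
  have hG := Real.integral_rpow_mul_exp_neg_mul_Ioi (a := 3 / 4) (r := N) (by norm_num) hN0
  have hgi : IntegrableOn (fun v : ℝ => v ^ ((3 / 4 : ℝ) - 1) * Real.exp (-(N * v))) (Ioi 0) := by
    have := integrableOn_rpow_mul_exp_neg_mul_rpow (s := (3 / 4 : ℝ) - 1) (p := 1) (b := N)
      (by norm_num) one_pos hN0
    simpa only [Real.rpow_one, neg_mul] using this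
  gcongr
  calc ∫ v in (0 : ℝ)..1, v ^ (-(1 / 4) : ℝ) * (1 - v) ^ N
      = ∫ v in Ioc (0 : ℝ) 1, v ^ (-(1 / 4) : ℝ) * (1 - v) ^ N :=
        intervalIntegral.integral_of_le zero_le_one
    _ ≤ ∫ v in Ioc (0 : ℝ) 1, v ^ ((3 / 4 : ℝ) - 1) * Real.exp (-(N * v)) := by
        refine setIntegral_mono_on ((intervalIntegrable_iff_integrableOn_Ioc_of_le zero_le_one).1 hi2)
          (hgi.mono_set Ioc_subset_Ioi_self) measurableSet_Ioc fun v hv => ?_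
        rw [show (3 / 4 : ℝ) - 1 = -(1 / 4) by norm_num]
        refine mul_le_mul_of_nonneg_left ?_ (Real.rpow_nonneg hv.1.le _)
        rw [show -(N * v) = N * (-v) by ring, Real.exp_nat_mul]
        refine pow_le_pow_left₀ (by linarith [hv.2]) ?_ N
        have := Real.add_one_le_exp (-v)
        linarith
    _ ≤ ∫ v in Ioi (0 : ℝ), v ^ ((3 / 4 : ℝ) - 1) * Real.exp (-(N * v)) := by
        refine setIntegral_mono_set hgi ?_ Ioc_subset_Ioi_self.eventuallyLE
        refine (ae_restrict_iff' measurableSet_Ioi).2 (Eventually.of_forall fun v hv => ?_)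
        have : (0 : ℝ) < v := hv
        simp only [Pi.zero_apply]
        positivity
    _ = Real.Gamma (3 / 4) / (N : ℝ) ^ (3 / 4 : ℝ) := by
        rw [hG, Real.div_rpow zero_le_one hN0.le, Real.one_rpow]
        ring

/-! ### Shifted Legendre polynomials and the expansion of the logarithm. -/

open Polynomial

/-- The shifted Legendre polynomial with real coefficients. -/
noncomputable def legendre (j : ℕ) : ℝ[X] := (shiftedLegendre j).map (Int.castRingHom ℝ)

theorem coeff_legendre (j k : ℕ) :
    (legendre j).coeff k = (-1) ^ k * j.choose k * (j + k).choose j := by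
  simp [legendre, coeff_shiftedLegendre]

theorem natDegree_legendre_le (j : ℕ) : (legendre j).natDegree ≤ j :=
  natDegree_map_le.trans (natDegree_shiftedLegendre j).le

theorem eval_legendre (j : ℕ) (u : ℝ) :
    (legendre j).eval u = ∑ k ∈ Finset.range (j + 1),
      ((j + k).choose k : ℝ) * (j.choose k : ℝ) * ((-1) ^ k * u ^ k) := by
  rw [eval_eq_sum_range' (Nat.lt_succ_of_le (natDegree_legendre_le j))]
  refine Finset.sum_congr rfl fun k _ => ?_
  rw [coeff_legendre, ← Nat.choose_symm_add]
  ring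

theorem eval_zero_legendre (j : ℕ) : (legendre j).eval 0 = 1 := by
  rw [← coeff_zero_eq_eval_zero, coeff_legendre]
  simp

theorem eval_one_legendre (j : ℕ) : (legendre j).eval 1 = (-1) ^ j := by
  have h := shiftedLegendre_eval_symm j (1 : ℝ)
  have e : ∀ x : ℝ, aeval x (shiftedLegendre j) = (legendre j).eval x := by
    intro x
    rw [legendre, aeval_def, eval_map]
    rfl
  rw [e, e, sub_self, eval_zero_legendre, mul_one] at h
  exact h

/-- Legendre's differential equation on `[0, 1]`. -/
theorem derivative_legendre_eq (j : ℕ) :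
    derivative (X * (1 - X) * derivative (legendre j)) =
      C (-((j : ℝ) * (j + 1))) * legendre j := by
  ext k
  have e : X * (1 - X) * derivative (legendre j) =
      X * derivative (legendre j) - X * (X * derivative (legendre j)) := by ring
  rw [e, derivative_sub, coeff_sub, coeff_derivative, coeff_derivative, coeff_X_mul, coeff_X_mul,
    coeff_derivative, coeff_C_mul]
  have e2 : (X * derivative (legendre j)).coeff k = k * (legendre j).coeff k := by
    cases k with
    | zero => simp
    | succ k => rw [coeff_X_mul, coeff_derivative]; push_cast; ring
  rw [e2, coeff_legendre, coeff_legendre]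
  -- With c_k the coefficients, the equation is the recurrence (k+1)² c_{k+1} = -(j-k)(j+k+1) c_k.
  rcases lt_or_ge j k with h | h
  · simp [Nat.choose_eq_zero_of_lt h, Nat.choose_eq_zero_of_lt (show j < k + 1 by omega)]
  · have h1 := Nat.choose_succ_right_eq j k
    have h2 := Nat.choose_mul_succ_eq (j + k) j
    rw [show j + k + 1 - j = k + 1 by omega] at h2
    have h1' : (j.choose (k + 1) : ℝ) * (k + 1) = j.choose k * (j - k) := by
      have := congrArg (Nat.cast (R := ℝ)) h1
      push_cast [Nat.cast_sub h] at this
      exact this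
    have h2' : ((j + k).choose j : ℝ) * (j + k + 1) = (j + (k + 1)).choose j * (k + 1) := by
      have := congrArg (Nat.cast (R := ℝ)) h2
      push_cast at this
      exact this
    rw [pow_succ]
    linear_combination (-(-1) ^ k * ((j + (k + 1)).choose j : ℝ) * (k + 1)) * h1' +
      ((-1) ^ k * (j.choose k : ℝ) * (j - k)) * h2'

theorem integral_eval_derivative (p : ℝ[X]) :
    ∫ v in (0 : ℝ)..1, (derivative p).eval v = p.eval 1 - p.eval 0 :=
  intervalIntegral.integral_eq_sub_of_hasDerivAt (fun v _ => p.hasDerivAt v)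
    ((derivative p).continuous.intervalIntegrable _ _)

theorem intervalIntegrable_eval (p : ℝ[X]) (x y : ℝ) :
    IntervalIntegrable (fun v => p.eval v) volume x y := p.continuous.intervalIntegrable x y

/-- The Legendre operator is symmetric, with eigenvalue -j(j+1) on `legendre j`. Moving it onto
x^(m+1) relates the moments of orders m+1 and m by the factor (m+1)(m+2) - j(j+1), nonzero for m+1 <
j. -/
theorem integral_pow_mul_legendre_eq_zero {j m : ℕ} (h : m < j) :
    ∫ v in (0 : ℝ)..1, (X ^ m * legendre j).eval v = 0 := by
  have hj : (0 : ℝ) < j := by exact_mod_cast (Nat.zero_le m).trans_lt h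
  induction m with
  | zero =>
    have h1 := integral_eval_derivative (X * (1 - X) * derivative (legendre j))
    rw [derivative_legendre_eq] at h1
    simp only [eval_mul, eval_C, eval_X, eval_sub, eval_one, sub_self, mul_zero, zero_mul,
      intervalIntegral.integral_const_mul] at h1
    simp only [pow_zero, one_mul]
    rcases mul_eq_zero.1 h1 with h2 | h2
    · nlinarith
    · exact h2
  | succ m ih =>
    have ih' := ih (by omega)
    have h1 := integral_eval_derivative (X ^ (m + 1) * (X * (1 - X) * derivative (legendre j)) -
      C ((m : ℝ) + 1) * (X ^ (m + 1) * (1 - X)) * legendre j)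
    have e : derivative (X ^ (m + 1) * (X * (1 - X) * derivative (legendre j)) -
        C ((m : ℝ) + 1) * (X ^ (m + 1) * (1 - X)) * legendre j) =
        C (((m : ℝ) + 1) * (m + 2) - j * (j + 1)) * (X ^ (m + 1) * legendre j) -
          C (((m : ℝ) + 1) ^ 2) * (X ^ m * legendre j) := by
      rw [derivative_sub, derivative_mul, derivative_legendre_eq, derivative_mul]
      simp only [derivative_mul, derivative_X_pow, derivative_C, derivative_one, derivative_X,
        Nat.add_sub_cancel, map_sub, map_add, map_mul, map_pow, map_neg, map_one]
      simp only [map_natCast, map_ofNat, Nat.cast_add, Nat.cast_one, map_add, map_one]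
      ring
    rw [e] at h1
    have e2 : ∀ v : ℝ, eval v (C (((m : ℝ) + 1) * (m + 2) - j * (j + 1)) *
        (X ^ (m + 1) * legendre j) - C (((m : ℝ) + 1) ^ 2) * (X ^ m * legendre j)) =
        (((m : ℝ) + 1) * (m + 2) - j * (j + 1)) * eval v (X ^ (m + 1) * legendre j) -
          ((m : ℝ) + 1) ^ 2 * eval v (X ^ m * legendre j) := by
      intro v
      rw [eval_sub, eval_C_mul, eval_C_mul]
    simp_rw [e2] at h1
    rw [intervalIntegral.integral_sub ((intervalIntegrable_eval _ _ _).const_mul _)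
      ((intervalIntegrable_eval _ _ _).const_mul _), intervalIntegral.integral_const_mul,
      intervalIntegral.integral_const_mul, ih'] at h1
    simp only [eval_sub, eval_mul, eval_pow, eval_X, eval_C, eval_one, sub_self, mul_zero, zero_mul,
      zero_pow (Nat.succ_ne_zero m), sub_zero] at h1
    rcases mul_eq_zero.1 h1 with h2 | h2
    · have h3 : (m : ℝ) + 1 < j := by exact_mod_cast h
      have : (0 : ℝ) ≤ m := m.cast_nonneg
      nlinarith
    · simpa only [eval_mul, eval_pow, eval_X] using h2

theorem integral_mul_legendre_eq_zero {p : ℝ[X]} {j : ℕ} (hp : ∀ m, j ≤ m → p.coeff m = 0) :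
    ∫ v in (0 : ℝ)..1, (p * legendre j).eval v = 0 := by
  have e : ∀ v : ℝ, (p * legendre j).eval v =
      ∑ m ∈ Finset.range (p.natDegree + 1), p.coeff m * (X ^ m * legendre j).eval v := by
    intro v
    rw [eval_mul, eval_eq_sum_range, Finset.sum_mul]
    simp only [eval_mul, eval_pow, eval_X, mul_assoc]
  simp_rw [e]
  rw [intervalIntegral.integral_finsetSum fun m _ => (intervalIntegrable_eval _ _ _).const_mul _]
  refine Finset.sum_eq_zero fun m _ => ?_
  rw [intervalIntegral.integral_const_mul]
  rcases lt_or_ge m j with h | h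
  · rw [integral_pow_mul_legendre_eq_zero h, mul_zero]
  · rw [hp m h, zero_mul]

/-- Integrate (xP²)' = P² + 2xPP'. As xP' - jP has degree below j, it is orthogonal to P, so the
right side integrates to (2j+1)∫P², while the boundary value is P(1)² = 1. -/
theorem integral_legendre_sq (j : ℕ) :
    ∫ v in (0 : ℝ)..1, (legendre j * legendre j).eval v = 1 / (2 * j + 1) := by
  have h1 := integral_eval_derivative (X * (legendre j * legendre j))
  have h0 : ∫ v in (0 : ℝ)..1, ((X * derivative (legendre j) - C (j : ℝ) * legendre j) *
      legendre j).eval v = 0 := by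
    refine integral_mul_legendre_eq_zero fun m hm => ?_
    have e2 : (X * derivative (legendre j)).coeff m = m * (legendre j).coeff m := by
      cases m with
      | zero => simp
      | succ k => rw [coeff_X_mul, coeff_derivative]; push_cast; ring
    rw [coeff_sub, e2, coeff_C_mul]
    rcases hm.eq_or_lt with h | h
    · rw [h, sub_self]
    · rw [coeff_eq_zero_of_natDegree_lt ((natDegree_legendre_le j).trans_lt h)]
      simp
  have e : ∀ v : ℝ, (derivative (X * (legendre j * legendre j))).eval v =
      (2 * j + 1) * (legendre j * legendre j).eval v +
        2 * ((X * derivative (legendre j) - C (j : ℝ) * legendre j) * legendre j).eval v := by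
    intro v
    simp only [derivative_mul, derivative_X, eval_add, eval_mul, eval_sub, eval_X, eval_C, eval_one]
    ring
  simp_rw [e] at h1
  rw [intervalIntegral.integral_add ((intervalIntegrable_eval _ _ _).const_mul _)
    ((intervalIntegrable_eval _ _ _).const_mul _), intervalIntegral.integral_const_mul,
    intervalIntegral.integral_const_mul, h0] at h1
  have h2 : ((-1 : ℝ) ^ j) * (-1) ^ j = 1 := by rw [← mul_pow]; norm_num
  simp only [eval_mul, eval_X, eval_one_legendre, one_mul, zero_mul, mul_zero, add_zero, sub_zero,
    h2] at h1 ⊢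
  rw [eq_div_iff (by positivity)]
  linarith

theorem intervalIntegrable_log_mul_eval (p : ℝ[X]) :
    IntervalIntegrable (fun v => Real.log v * p.eval v) volume 0 1 :=
  intervalIntegral.intervalIntegrable_log'.mul_continuousOn p.continuous.continuousOn

/-- Put the differential equation in the form -j(j+1)P = (xS)' with S = (1-x)P' and integrate by
parts against log: only -∫S = P(0) - ∫P = 1 remains. -/
theorem integral_log_mul_legendre {j : ℕ} (hj : 1 ≤ j) :
    ∫ v in (0 : ℝ)..1, Real.log v * (legendre j).eval v = -(1 / (j * (j + 1))) := by
  have hj0 : (0 : ℝ) < j := by exact_mod_cast hj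
  set S : ℝ[X] := (1 - X) * derivative (legendre j) with hS
  have hode : derivative (X * S) = C (-((j : ℝ) * (j + 1))) * legendre j := by
    rw [← derivative_legendre_eq, hS, mul_assoc]
  have hi : IntervalIntegrable (fun v => -((j : ℝ) * (j + 1)) *
      (Real.log v * (legendre j).eval v) + S.eval v) volume 0 1 :=
    ((intervalIntegrable_log_mul_eval _).const_mul _).add (intervalIntegrable_eval _ _ _)
  have hintegrable : ∫ v in (0 : ℝ)..1, (-((j : ℝ) * (j + 1)) *
      (Real.log v * (legendre j).eval v) + S.eval v) = 0 := by
    rw [intervalIntegral.integral_eq_sub_of_hasDerivAt_of_le zero_le_one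
      (f := fun v => v * Real.log v * S.eval v) ?_ ?_ hi]
    · simp
    · exact (Real.continuous_mul_log.mul S.continuous).continuousOn
    · intro v hv
      have h := (Real.hasDerivAt_mul_log hv.1.ne').mul (S.hasDerivAt v)
      refine h.congr_deriv ?_
      have h2 := congrArg (eval v) hode
      simp only [derivative_mul, derivative_X, eval_add, eval_mul, eval_X, eval_C, eval_one] at h2
      linear_combination (-Real.log v) * h2.symm
  rw [intervalIntegral.integral_add ((intervalIntegrable_log_mul_eval _).const_mul _)
    (intervalIntegrable_eval _ _ _), intervalIntegral.integral_const_mul] at hintegrable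
  have hSint : ∫ v in (0 : ℝ)..1, S.eval v = -1 := by
    have h1 := integral_eval_derivative ((1 - X) * legendre j)
    have h0 := integral_pow_mul_legendre_eq_zero (j := j) (m := 0) (by omega)
    have e : ∀ v : ℝ, (derivative ((1 - X) * legendre j)).eval v =
        S.eval v - (X ^ 0 * legendre j).eval v := by
      intro v
      simp only [hS, derivative_mul, derivative_sub, derivative_one, derivative_X, eval_add,
        eval_mul, eval_sub, eval_X, eval_one, eval_zero, eval_pow]
      ring
    simp_rw [e] at h1
    rw [intervalIntegral.integral_sub (intervalIntegrable_eval _ _ _)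
      (intervalIntegrable_eval _ _ _), h0] at h1
    simpa [eval_zero_legendre] using h1
  rw [hSint] at hintegrable
  field_simp
  linarith

/-- The remainder of the shifted Legendre expansion of `log`. -/
noncomputable def legendreTail (N : ℕ) (v : ℝ) : ℝ :=
  Real.log v + 1 + ∑ j ∈ Finset.Icc 1 N,
    (2 * (j : ℝ) + 1) / ((j : ℝ) * ((j : ℝ) + 1)) * (legendre j).eval v

theorem legendreTail_succ (N : ℕ) (v : ℝ) :
    legendreTail (N + 1) v = legendreTail N v +
      (2 * ((N : ℝ) + 1) + 1) / (((N : ℝ) + 1) * ((N : ℝ) + 1 + 1)) *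
        (legendre (N + 1)).eval v := by
  rw [legendreTail, legendreTail, Finset.sum_Icc_succ_top (by omega)]
  push_cast
  ring

theorem legendreTail_eq_log_add_eval (N : ℕ) : ∃ p : ℝ[X], (∀ m, N + 1 ≤ m → p.coeff m = 0) ∧
    ∀ v, legendreTail N v = Real.log v + p.eval v := by
  refine ⟨1 + ∑ j ∈ Finset.Icc 1 N,
    C ((2 * (j : ℝ) + 1) / ((j : ℝ) * ((j : ℝ) + 1))) * legendre j, fun m hm => ?_, fun v => ?_⟩
  · rw [coeff_add, coeff_one, if_neg (by omega), zero_add, finsetSum_coeff]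
    refine Finset.sum_eq_zero fun j hj => ?_
    have := (Finset.mem_Icc.1 hj).2
    rw [coeff_C_mul, coeff_eq_zero_of_natDegree_lt ((natDegree_legendre_le j).trans_lt (by omega)),
      mul_zero]
  · rw [legendreTail, eval_add, eval_finsetSum]
    simp only [eval_mul, eval_C, eval_one]
    ring

theorem intervalIntegrable_log_sq :
    IntervalIntegrable (fun v => Real.log v ^ 2) volume 0 1 := by
  have h1 : IntervalIntegrable (fun v : ℝ => v ^ (-(1 / 2) : ℝ)) volume 0 1 :=
    intervalIntegral.intervalIntegrable_rpow' (by norm_num)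
  have h2 := h1.mul_continuousOn (g := fun v : ℝ => (v ^ (1 / 4 : ℝ) * Real.log v) ^ 2)
    (((continuousOn_rpow_mul_log (s := 1 / 4) (by norm_num)).pow 2).mono (by
      rw [uIcc_of_le zero_le_one]; exact Icc_subset_Ici_self))
  refine h2.congr_ae ?_
  rw [uIoc_of_le zero_le_one]
  refine (ae_restrict_iff' measurableSet_Ioc).2 (Eventually.of_forall fun v hv => ?_)
  simp only
  rw [mul_pow, ← mul_assoc, ← Real.rpow_natCast (v ^ (1 / 4 : ℝ)), ← Real.rpow_mul hv.1.le,
    ← Real.rpow_add hv.1]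
  norm_num

theorem intervalIntegrable_legendreTail_sq (N : ℕ) :
    IntervalIntegrable (fun v => legendreTail N v ^ 2) volume 0 1 := by
  obtain ⟨p, -, hp⟩ := legendreTail_eq_log_add_eval N
  have h := (intervalIntegrable_log_sq.add ((intervalIntegrable_log_mul_eval p).const_mul 2)).add
    (intervalIntegrable_eval (p ^ 2) 0 1)
  refine h.congr fun v _ => ?_
  simp only [hp, eval_pow]
  ring

theorem integral_legendreTail_mul_legendre (N : ℕ) :
    IntervalIntegrable (fun v => legendreTail N v * (legendre (N + 1)).eval v) volume 0 1 ∧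
    ∫ v in (0 : ℝ)..1, legendreTail N v * (legendre (N + 1)).eval v =
      -(1 / (((N : ℝ) + 1) * ((N : ℝ) + 1 + 1))) := by
  obtain ⟨p, hp0, hp⟩ := legendreTail_eq_log_add_eval N
  have e : ∀ v, legendreTail N v * (legendre (N + 1)).eval v =
      Real.log v * (legendre (N + 1)).eval v + (p * legendre (N + 1)).eval v := by
    intro v
    rw [hp, eval_mul]
    ring
  simp_rw [e]
  refine ⟨(intervalIntegrable_log_mul_eval _).add (intervalIntegrable_eval _ _ _), ?_⟩
  rw [intervalIntegral.integral_add (intervalIntegrable_log_mul_eval _)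
    (intervalIntegrable_eval _ _ _), integral_log_mul_legendre (by omega),
    integral_mul_legendre_eq_zero hp0]
  push_cast
  ring

/-- Adding the next Legendre term lowers the squared norm by (2N+3)/((N+1)²(N+2)²) = 1/(N+1)² -
1/(N+2)², so the sum telescopes. -/
theorem integral_legendreTail_sq (N : ℕ) :
    ∫ v in (0 : ℝ)..1, legendreTail N v ^ 2 = 1 / ((N : ℝ) + 1) ^ 2 := by
  induction N with
  | zero =>
    have e : ∀ v, legendreTail 0 v = Real.log v + 1 := fun v => by simp [legendreTail]
    have hi := intervalIntegrable_legendreTail_sq 0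
    simp_rw [e] at hi ⊢
    rw [intervalIntegral.integral_eq_sub_of_hasDerivAt_of_le zero_le_one
      (f := fun v => v + v * Real.log v ^ 2) ?_ ?_ hi]
    · simp
    · have h1 : ContinuousOn (fun v : ℝ => v + (v ^ (1 / 2 : ℝ) * Real.log v) ^ 2) (Icc 0 1) :=
        continuousOn_id.add (((continuousOn_rpow_mul_log (by norm_num)).pow 2).mono
          Icc_subset_Ici_self)
      refine h1.congr fun v hv => ?_
      simp only
      rw [mul_pow, ← Real.sqrt_eq_rpow, Real.sq_sqrt hv.1]
    · intro v hv
      have h := (hasDerivAt_id v).add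
        ((hasDerivAt_id v).mul ((Real.hasDerivAt_log hv.1.ne').pow 2))
      refine h.congr_deriv ?_
      have := hv.1.ne'
      simp only [id, Pi.pow_apply]
      field_simp
      ring
  | succ N ih =>
    obtain ⟨hi, hval⟩ := integral_legendreTail_mul_legendre N
    set A : ℝ := (2 * ((N : ℝ) + 1) + 1) / (((N : ℝ) + 1) * ((N : ℝ) + 1 + 1)) with hA
    have e : ∀ v, legendreTail (N + 1) v ^ 2 = legendreTail N v ^ 2 +
        2 * A * (legendreTail N v * (legendre (N + 1)).eval v) +
          A ^ 2 * (legendre (N + 1) * legendre (N + 1)).eval v := by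
      intro v
      rw [legendreTail_succ, eval_mul]
      ring
    simp_rw [e]
    rw [intervalIntegral.integral_add ((intervalIntegrable_legendreTail_sq N).add (hi.const_mul _))
      ((intervalIntegrable_eval _ _ _).const_mul _),
      intervalIntegral.integral_add (intervalIntegrable_legendreTail_sq N) (hi.const_mul _),
      intervalIntegral.integral_const_mul, intervalIntegral.integral_const_mul, hval, ih,
      integral_legendre_sq, hA]
    push_cast
    field_simp
    ring

/-- Weighted AM–GM, xy ≤ x²/(2L) + Ly²/2 with L = N+1, in place of Cauchy–Schwarz; this L balances
∫v^(-1/2) = 2 against the squared norm 1/L². -/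
theorem integral_rpow_mul_abs_legendreTail_le (N : ℕ) :
    IntervalIntegrable (fun v : ℝ => v ^ (-(1 / 4) : ℝ) * |legendreTail N v|) volume 0 1 ∧
    ∫ v in (0 : ℝ)..1, v ^ (-(1 / 4) : ℝ) * |legendreTail N v| ≤ 3 / (2 * ((N : ℝ) + 1)) := by
  obtain ⟨p, -, hp⟩ := legendreTail_eq_log_add_eval N
  have hr : IntervalIntegrable (fun v : ℝ => v ^ (-(1 / 2) : ℝ)) volume 0 1 :=
    intervalIntegral.intervalIntegrable_rpow' (by norm_num)
  have hs := intervalIntegrable_legendreTail_sq N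
  have hi : IntervalIntegrable (fun v : ℝ => v ^ (-(1 / 4) : ℝ) * |legendreTail N v|)
      volume 0 1 := by
    have h1 : IntervalIntegrable (fun v : ℝ => v ^ (-(1 / 4) : ℝ) * legendreTail N v)
        volume 0 1 := by
      have h2 := (intervalIntegrable_rpow_mul_log (s := -(1 / 4)) (by norm_num)).add
        ((intervalIntegral.intervalIntegrable_rpow' (r := -(1 / 4)) (a := 0) (b := 1)
          (by norm_num)).mul_continuousOn p.continuous.continuousOn)
      refine h2.congr fun v _ => ?_
      simp only [hp]
      ring
    refine h1.abs.congr fun v hv => ?_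
    rw [uIoc_of_le zero_le_one] at hv
    simp only [abs_mul, abs_of_nonneg (Real.rpow_nonneg hv.1.le _)]
  refine ⟨hi, ?_⟩
  set L : ℝ := (N : ℝ) + 1 with hL
  have hL0 : 0 < L := by positivity
  have hle : ∫ v in (0 : ℝ)..1, v ^ (-(1 / 4) : ℝ) * |legendreTail N v| ≤
      ∫ v in (0 : ℝ)..1, (1 / (2 * L) * v ^ (-(1 / 2) : ℝ) + L / 2 * legendreTail N v ^ 2) := by
    refine intervalIntegral.integral_mono_on zero_le_one hi
      ((hr.const_mul _).add (hs.const_mul _)) fun v hv => ?_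
    have e : v ^ (-(1 / 2) : ℝ) = (v ^ (-(1 / 4) : ℝ)) ^ 2 := by
      rw [← Real.rpow_natCast, ← Real.rpow_mul hv.1]
      norm_num
    rw [e, ← sq_abs (legendreTail N v)]
    set x := v ^ (-(1 / 4) : ℝ)
    set y := |legendreTail N v|
    have : 1 / (2 * L) * x ^ 2 + L / 2 * y ^ 2 - x * y = (x - L * y) ^ 2 / (2 * L) := by
      field_simp
      ring
    have h2 : 0 ≤ (x - L * y) ^ 2 / (2 * L) := by positivity
    linarith
  refine hle.trans_eq ?_
  rw [intervalIntegral.integral_add (hr.const_mul _) (hs.const_mul _),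
    intervalIntegral.integral_const_mul, intervalIntegral.integral_const_mul,
    integral_legendreTail_sq, integral_rpow (Or.inl (by norm_num))]
  norm_num
  rw [← hL]
  field_simp
  norm_num

/-! ### Finiteness of G. -/

/-- Four nonzero coefficients make the product O(t^(-2)), so with t · t^(-1/2) the integrand is
O(t^(-3/2)) at infinity; on (0, 1] it is at most 1. -/
theorem G_lt_top {n : ℕ} {D : Fin (n + 1) → ℂ} (hD : D ≠ 0) (h4 : 4 ≤ {i | D i ≠ 0}.ncard) :
    G D < ∞ := by
  classical
  have hpi := Real.pi_pos
  have hc := c_pos hD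
  obtain ⟨S, hS, hcard⟩ := Finset.exists_subset_card_eq
    (s := Finset.univ.filter fun i => D i ≠ 0) (n := 4) (by
      rw [← Set.ncard_coe_finset]; simpa using h4)
  have hne : ∀ i ∈ S, 0 < ‖D i‖ := fun i hi => norm_pos_iff.2 (Finset.mem_filter.1 (hS hi)).2
  set A : Fin (n + 1) → ℝ := fun i => (Real.pi / 2 * ‖D i‖) ^ (-(1 / 2) : ℝ) with hA
  set B : ℝ := (Real.pi / 2 * c D) ^ (-(1 / 2) : ℝ) with hB
  have hA0 : ∀ i, 0 ≤ A i := fun i => Real.rpow_nonneg (by positivity) _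
  have hB0 : 0 ≤ B := Real.rpow_nonneg (by positivity) _
  have hprod1 : ∀ t, ∏ i, |besselJ0 (‖D i‖ * t)| ≤ 1 := fun t =>
    Finset.prod_le_one (fun _ _ => abs_nonneg _) fun _ _ => abs_besselJ0_le_one _
  rw [G_eq, besselProductIntegral, ← Ioc_union_Ioi_eq_Ioi (zero_le_one (α := ℝ)),
    lintegral_union measurableSet_Ioi Ioc_disjoint_Ioi_same]
  refine ENNReal.mul_lt_top ENNReal.ofReal_lt_top (ENNReal.add_lt_top.2 ⟨?_, ?_⟩)
  · have hle : ∀ t ∈ Ioc (0 : ℝ) 1, ENNReal.ofReal (t *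
        (max 1 (Real.pi / 2 * c D * t)) ^ (-(1 / 2) : ℝ) * ∏ i, |besselJ0 (‖D i‖ * t)|) ≤ 1 := by
      intro t ht
      rw [← ENNReal.ofReal_one]
      refine ENNReal.ofReal_le_ofReal ?_
      have h1 : (max 1 (Real.pi / 2 * c D * t)) ^ (-(1 / 2) : ℝ) ≤ 1 :=
        Real.rpow_le_one_of_one_le_of_nonpos (le_max_left _ _) (by norm_num)
      refine mul_le_one₀ (mul_le_one₀ ht.2 ?_ h1)
        (Finset.prod_nonneg fun _ _ => abs_nonneg _) (hprod1 t)
      positivity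
    refine (setLIntegral_mono' measurableSet_Ioc hle).trans_lt ?_
    simp
  · have hle : ∀ t ∈ Ioi (1 : ℝ), ENNReal.ofReal (t *
        (max 1 (Real.pi / 2 * c D * t)) ^ (-(1 / 2) : ℝ) * ∏ i, |besselJ0 (‖D i‖ * t)|) ≤
        ENNReal.ofReal ((B * ∏ i ∈ S, A i) * t ^ (-(3 / 2) : ℝ)) := by
      intro t ht
      have ht0 : (0 : ℝ) < t := one_pos.trans ht
      refine ENNReal.ofReal_le_ofReal ?_
      have h1 : (max 1 (Real.pi / 2 * c D * t)) ^ (-(1 / 2) : ℝ) ≤ B * t ^ (-(1 / 2) : ℝ) := by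
        rw [hB, ← Real.mul_rpow (by positivity) ht0.le]
        exact Real.rpow_le_rpow_of_nonpos (by positivity) (le_max_right _ _) (by norm_num)
      have h2 : ∏ i, |besselJ0 (‖D i‖ * t)| ≤ (∏ i ∈ S, A i) * (t ^ (-(1 / 2) : ℝ)) ^ 4 := by
        rw [← hcard, ← Finset.prod_const, ← Finset.prod_mul_distrib]
        calc ∏ i, |besselJ0 (‖D i‖ * t)| ≤ ∏ i ∈ S, |besselJ0 (‖D i‖ * t)| := by
              rw [← Finset.prod_mul_prod_compl S]
              exact mul_le_of_le_one_right (Finset.prod_nonneg fun _ _ => abs_nonneg _)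
                (Finset.prod_le_one (fun _ _ => abs_nonneg _) fun _ _ => abs_besselJ0_le_one _)
          _ ≤ _ := by
              refine Finset.prod_le_prod (fun _ _ => abs_nonneg _) fun i hi => ?_
              have := hne i hi
              refine (abs_besselJ0_le_max (by positivity)).trans ?_
              rw [hA, ← Real.mul_rpow (by positivity) ht0.le]
              refine Real.rpow_le_rpow_of_nonpos (by positivity) ?_ (by norm_num)
              rw [mul_assoc]
              exact le_max_right _ _
      have e : t * t ^ (-(1 / 2) : ℝ) * (t ^ (-(1 / 2) : ℝ)) ^ 4 = t ^ (-(3 / 2) : ℝ) := by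
        rw [← Real.rpow_natCast, ← Real.rpow_mul ht0.le, ← Real.rpow_one_add' ht0.le (by norm_num),
          ← Real.rpow_add ht0]
        norm_num
      calc t * (max 1 (Real.pi / 2 * c D * t)) ^ (-(1 / 2) : ℝ) * ∏ i, |besselJ0 (‖D i‖ * t)|
          ≤ t * (B * t ^ (-(1 / 2) : ℝ)) * ((∏ i ∈ S, A i) * (t ^ (-(1 / 2) : ℝ)) ^ 4) := by
            gcongr
        _ = (B * ∏ i ∈ S, A i) * (t * t ^ (-(1 / 2) : ℝ) * (t ^ (-(1 / 2) : ℝ)) ^ 4) := by ring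
        _ = _ := by rw [e]
    refine (setLIntegral_mono' measurableSet_Ioi hle).trans_lt ?_
    have hintegrable : IntegrableOn (fun t : ℝ => (B * ∏ i ∈ S, A i) * t ^ (-(3 / 2) : ℝ)) (Ioi 1) :=
      (integrableOn_Ioi_rpow_of_lt (by norm_num) one_pos).const_mul _
    exact hintegrable.lintegral_lt_top

/-! ### Error formulas and final estimates. -/

/-- The normalized square modulus of the linear form on the torus. -/
noncomputable def normalizedNormSq {n : ℕ} (D : Fin (n + 1) → ℂ) (θ : Fin (n + 1) → ℝ) : ℝ :=
  ‖torusValue D θ‖ ^ 2 / c D ^ 2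

theorem continuous_normalizedNormSq {n : ℕ} (D : Fin (n + 1) → ℂ) :
    Continuous (normalizedNormSq D) := by
  have := continuous_torusValue D
  unfold normalizedNormSq; fun_prop

theorem integrable_normalizedNormSq_comp {n : ℕ} {D : Fin (n + 1) → ℂ} (hc : 0 < c D)
    (hG : G D ≠ ∞) {h : ℝ → ℝ} (hh : Measurable h)
    (hi : IntervalIntegrable (fun v : ℝ => v ^ (-(1 / 4) : ℝ) * |h v|) volume 0 1) :
    Integrable (fun θ => h (normalizedNormSq D θ)) (torusMeasure (Fin (n + 1))) ∧
    ENNReal.ofReal |∫ θ, h (normalizedNormSq D θ) ∂torusMeasure (Fin (n + 1))| ≤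
      G D / 2 * ENNReal.ofReal (∫ v in (0 : ℝ)..1, v ^ (-(1 / 4) : ℝ) * |h v|) := by
  have hkey := lintegral_normSq_torusValue_le D hc hG (h := fun v => ‖h v‖ₑ) (by fun_prop)
  have e : ∫⁻ v in Ioc (0 : ℝ) 1, ENNReal.ofReal (v ^ (-(1 / 4) : ℝ)) * ‖h v‖ₑ =
      ENNReal.ofReal (∫ v in (0 : ℝ)..1, v ^ (-(1 / 4) : ℝ) * |h v|) := by
    rw [intervalIntegral.integral_of_le zero_le_one, ofReal_integral_eq_lintegral_ofReal
      ((intervalIntegrable_iff_integrableOn_Ioc_of_le zero_le_one).1 hi)]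
    · refine setLIntegral_congr_fun measurableSet_Ioc fun v hv => ?_
      rw [ENNReal.ofReal_mul (Real.rpow_nonneg hv.1.le _), ← Real.norm_eq_abs, ofReal_norm]
    · refine (ae_restrict_iff' measurableSet_Ioc).2 (Eventually.of_forall fun v hv => ?_)
      exact mul_nonneg (Real.rpow_nonneg hv.1.le _) (abs_nonneg _)
  rw [e] at hkey
  refine ⟨⟨(hh.comp (continuous_normalizedNormSq D).measurable).aestronglyMeasurable, ?_⟩, ?_⟩
  · exact hkey.trans_lt (ENNReal.mul_lt_top (ENNReal.div_lt_top hG two_ne_zero)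
      ENNReal.ofReal_lt_top)
  · rw [← Real.norm_eq_abs, ofReal_norm]
    exact (enorm_integral_le_lintegral_enorm _).trans hkey

/-- The density bound shows that U has no atom at 0. This is needed because log |P_D| = log c +
(1/2) log U can fail at zeros of P_D under the convention `Real.log 0 = 0`. -/
theorem ae_torusValue_ne_zero {n : ℕ} {D : Fin (n + 1) → ℂ} (hc : 0 < c D) (hG : G D ≠ ∞) :
    ∀ᵐ θ ∂torusMeasure (Fin (n + 1)), torusValue D θ ≠ 0 := by
  have hkey := lintegral_normSq_torusValue_le D hc hG (h := ({0} : Set ℝ).indicator 1)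
    (measurable_one.indicator (measurableSet_singleton 0))
  have h0 : ∫⁻ v in Ioc (0 : ℝ) 1, ENNReal.ofReal (v ^ (-(1 / 4) : ℝ)) *
      ({0} : Set ℝ).indicator 1 v = 0 := by
    rw [setLIntegral_congr_fun (g := fun _ => 0) measurableSet_Ioc fun v hv => ?_]
    · simp
    · rw [indicator_of_notMem (by simpa using hv.1.ne'), mul_zero]
  rw [h0, mul_zero, nonpos_iff_eq_zero, lintegral_eq_zero_iff] at hkey
  · filter_upwards [hkey] with θ hθ hz
    simp [hz] at hθ
  · exact (measurable_one.indicator (measurableSet_singleton 0)).comp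
      (continuous_normalizedNormSq D).measurable

theorem integrable_of_continuous_torus {d : ℕ} {f : (Fin d → ℝ) → ℝ} (hf : Continuous f) :
    Integrable f (torusMeasure (Fin d)) := by
  rw [torusMeasure_eq_smul_restrict]
  exact hf.integrableOn_Icc.smul_measure ENNReal.ofReal_ne_top

theorem integral_normalizedNormSq_pow {n : ℕ} (D : Fin (n + 1) → ℂ) (k : ℕ) :
    ∫ θ, normalizedNormSq D θ ^ k ∂torusMeasure (Fin (n + 1)) = a k D / c D ^ (2 * k) := by
  rw [← integral_norm_torusValue_pow, ← integral_div]
  simp only [normalizedNormSq, div_pow, ← pow_mul]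

theorem integral_sum_mul_pow {n : ℕ} (D : Fin (n + 1) → ℂ) (j : ℕ) (w : ℕ → ℝ) :
    ∫ θ, ∑ k ∈ Finset.range (j + 1), w k * ((-1) ^ k * normalizedNormSq D θ ^ k)
      ∂torusMeasure (Fin (n + 1)) =
      ∑ k ∈ Finset.range (j + 1), w k * ((-1) ^ k * a k D / c D ^ (2 * k)) := by
  have hU := continuous_normalizedNormSq D
  rw [integral_finsetSum _ fun k _ => integrable_of_continuous_torus (by fun_prop)]
  refine Finset.sum_congr rfl fun k _ => ?_
  rw [integral_const_mul, integral_const_mul, integral_normalizedNormSq_pow, mul_div_assoc]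

theorem one_sub_pow_eq_sum (u : ℝ) (j : ℕ) :
    (1 - u) ^ j = ∑ k ∈ Finset.range (j + 1), (j.choose k : ℝ) * ((-1) ^ k * u ^ k) := by
  rw [show 1 - u = -u + 1 by ring, add_pow]
  refine Finset.sum_congr rfl fun k _ => ?_
  rw [neg_pow, one_pow]
  ring

theorem measurable_logTail (N : ℕ) : Measurable (logTail N) := by
  unfold logTail
  fun_prop

theorem intervalIntegrable_rpow_mul_abs_logTail (N : ℕ) :
    IntervalIntegrable (fun v : ℝ => v ^ (-(1 / 4) : ℝ) * |logTail N v|) volume 0 1 := by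
  refine (intervalIntegrable_rpow_mul_logTail N).abs.congr fun v hv => ?_
  rw [uIoc_of_le zero_le_one] at hv
  simp only [abs_mul, abs_of_nonneg (Real.rpow_nonneg hv.1.le _)]

theorem integrable_log_normalizedNormSq {n : ℕ} {D : Fin (n + 1) → ℂ} (hc : 0 < c D)
    (hG : G D ≠ ∞) :
    Integrable (fun θ => Real.log (normalizedNormSq D θ)) (torusMeasure (Fin (n + 1))) := by
  have h := (integrable_normalizedNormSq_comp hc hG (measurable_logTail 0)
    (intervalIntegrable_rpow_mul_abs_logTail 0)).1.neg
  refine h.congr (Eventually.of_forall fun θ => ?_)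
  simp [logTail]

theorem logMahlerMeasure_linearForm_eq {n : ℕ} {D : Fin (n + 1) → ℂ} (hc : 0 < c D)
    (hG : G D ≠ ∞) :
    logMahlerMeasure (linearForm D) = Real.log (c D) +
      1 / 2 * ∫ θ, Real.log (normalizedNormSq D θ) ∂torusMeasure (Fin (n + 1)) := by
  have hae : (fun θ => Real.log ‖torusValue D θ‖) =ᵐ[torusMeasure (Fin (n + 1))]
      fun θ => Real.log (c D) + 1 / 2 * Real.log (normalizedNormSq D θ) := by
    filter_upwards [ae_torusValue_ne_zero hc hG] with θ hθ
    have : 0 < ‖torusValue D θ‖ := norm_pos_iff.2 hθ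
    rw [normalizedNormSq, Real.log_div (by positivity) (by positivity), Real.log_pow, Real.log_pow]
    push_cast
    ring
  rw [logMahlerMeasure_linearForm, integral_congr_ae hae, integral_add (integrable_const _)
    ((integrable_log_normalizedNormSq hc hG).const_mul _), integral_const_mul]
  simp

theorem logMahlerMeasure_sub_E₁ {n : ℕ} {D : Fin (n + 1) → ℂ} (hc : 0 < c D)
    (hG : G D ≠ ∞) (N : ℕ) :
    logMahlerMeasure (linearForm D) - E₁ N D =
      -(1 / 2) * ∫ θ, logTail N (normalizedNormSq D θ) ∂torusMeasure (Fin (n + 1)) := by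
  have hU := continuous_normalizedNormSq D
  simp only [logTail]
  rw [integral_sub (f := fun θ => -Real.log (normalizedNormSq D θ))
    (integrable_log_normalizedNormSq hc hG).neg
    (integrable_of_continuous_torus (by fun_prop)), integral_neg,
    integral_finsetSum _ fun j _ => integrable_of_continuous_torus (by fun_prop),
    logMahlerMeasure_linearForm_eq hc hG, E₁]
  simp_rw [integral_const_mul, one_sub_pow_eq_sum, integral_sum_mul_pow]
  ring

theorem logMahlerMeasure_sub_E₂ {n : ℕ} {D : Fin (n + 1) → ℂ} (hc : 0 < c D)
    (hG : G D ≠ ∞) (N : ℕ) :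
    logMahlerMeasure (linearForm D) - E₂ N D =
      1 / 2 * ∫ θ, legendreTail N (normalizedNormSq D θ) ∂torusMeasure (Fin (n + 1)) := by
  have hU := continuous_normalizedNormSq D
  simp only [legendreTail]
  have hP : ∀ j, Continuous fun θ => (legendre j).eval (normalizedNormSq D θ) :=
    fun j => (legendre j).continuous.comp hU
  rw [integral_add (f := fun θ => Real.log (normalizedNormSq D θ) + 1)
    ((integrable_log_normalizedNormSq hc hG).add (integrable_const _))
    (integrable_of_continuous_torus (by fun_prop)),
    integral_add (integrable_log_normalizedNormSq hc hG) (integrable_const _),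
    integral_finsetSum _ fun j _ => integrable_of_continuous_torus (by fun_prop),
    logMahlerMeasure_linearForm_eq hc hG, E₂]
  simp_rw [integral_const_mul, eval_legendre, integral_sum_mul_pow]
  simp
  ring

theorem ofReal_mul_half_mul_ofReal {x : ℝ} (hx : 0 ≤ x) (y : ℝ) (g : ℝ≥0∞) :
    ENNReal.ofReal x * (g / 2 * ENNReal.ofReal y) = ENNReal.ofReal (x * (1 / 2) * y) * g := by
  have h2 : (2 : ℝ≥0∞)⁻¹ = ENNReal.ofReal (1 / 2) := by
    rw [one_div, ENNReal.ofReal_inv_of_pos two_pos]; norm_num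
  rw [div_eq_mul_inv, h2, ENNReal.ofReal_mul (by positivity), ENNReal.ofReal_mul hx]
  ring

theorem ofReal_abs_sub_E₁_le {n : ℕ} {D : Fin (n + 1) → ℂ} (hc : 0 < c D) (hG : G D ≠ ∞) {N : ℕ}
    (hN : 1 ≤ N) :
    ENNReal.ofReal |logMahlerMeasure (linearForm D) - E₁ N D| ≤
      ENNReal.ofReal (Real.Gamma (3 / 4) / 3 / (N : ℝ) ^ (3 / 4 : ℝ)) * G D := by
  have hi := intervalIntegrable_rpow_mul_abs_logTail N
  have hintegrable : ∫ v in (0 : ℝ)..1, v ^ (-(1 / 4) : ℝ) * |logTail N v| =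
      ∫ v in (0 : ℝ)..1, v ^ (-(1 / 4) : ℝ) * logTail N v := by
    rw [intervalIntegral.integral_of_le zero_le_one, intervalIntegral.integral_of_le zero_le_one]
    refine setIntegral_congr_fun measurableSet_Ioc fun v hv => ?_
    simp only [abs_of_nonneg (logTail_nonneg N hv.1 hv.2)]
  have h := (integrable_normalizedNormSq_comp hc hG (measurable_logTail N) hi).2
  rw [hintegrable] at h
  have h' := h.trans (mul_le_mul_right (ENNReal.ofReal_le_ofReal
    (integral_rpow_mul_logTail_le hN)) (G D / 2))
  rw [logMahlerMeasure_sub_E₁ hc hG, abs_mul, ENNReal.ofReal_mul (abs_nonneg _)]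
  refine (mul_le_mul_right h' _).trans_eq ?_
  rw [ofReal_mul_half_mul_ofReal (abs_nonneg _)]
  congr 2
  -- The constant is (1/2)(1/2)(4/3) = 1/3, from log|P_D| as half a log of U, the density factor
  -- G/2, and the integration by parts.
  rw [abs_of_neg (by norm_num)]
  ring

theorem ofReal_abs_sub_E₂_le {n : ℕ} {D : Fin (n + 1) → ℂ} (hc : 0 < c D) (hG : G D ≠ ∞) {N : ℕ}
    (hN : 1 ≤ N) :
    ENNReal.ofReal |logMahlerMeasure (linearForm D) - E₂ N D| ≤
      ENNReal.ofReal (2 * (2 : ℝ) ^ (1 / 4 : ℝ) / Real.sqrt N) * G D := by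
  have hN0 : (0 : ℝ) < N := by exact_mod_cast hN
  obtain ⟨hi, hle⟩ := integral_rpow_mul_abs_legendreTail_le N
  have hm : Measurable (legendreTail N) := by
    obtain ⟨p, -, hp⟩ := legendreTail_eq_log_add_eval N
    rw [funext hp]
    exact Real.measurable_log.add p.continuous.measurable
  have h' := (integrable_normalizedNormSq_comp hc hG hm hi).2.trans
    (mul_le_mul_right (ENNReal.ofReal_le_ofReal hle) (G D / 2))
  rw [logMahlerMeasure_sub_E₂ hc hG, abs_mul, ENNReal.ofReal_mul (abs_nonneg _)]
  refine (mul_le_mul_right h' _).trans ?_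
  rw [ofReal_mul_half_mul_ofReal (abs_nonneg _)]
  gcongr
  have hs : Real.sqrt N ≤ N + 1 := by
    rw [Real.sqrt_le_left (by positivity)]
    nlinarith
  have hs0 : 0 < Real.sqrt N := Real.sqrt_pos.2 hN0
  have hr : (1 : ℝ) ≤ 2 ^ (1 / 4 : ℝ) := Real.one_le_rpow (by norm_num) (by norm_num)
  rw [abs_of_pos (by norm_num : (0 : ℝ) < 1 / 2)]
  -- The argument yields 3G/(8(N+1)); the rest only weakens it to the stated form.
  calc 1 / 2 * (1 / 2) * (3 / (2 * ((N : ℝ) + 1))) = (3 / 8) / ((N : ℝ) + 1) := by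
        field_simp; norm_num
    _ ≤ (3 / 8) / Real.sqrt N := by gcongr
    _ ≤ _ := by
      gcongr
      linarith

end LinearMahler

open LinearMahler in
theorem theorem1p4 (n : ℕ) (hn : 3 ≤ n) (D : Fin (n + 1) → ℂ) (hD : D ≠ 0) :
    (4 ≤ {i | D i ≠ 0}.ncard → G D < ∞) ∧
    ∀ N : ℕ, 1 ≤ N →
      ENNReal.ofReal |logMahlerMeasure (linearForm D) - E₁ N D| ≤
        ENNReal.ofReal (Real.Gamma (3 / 4) / 3 / (N : ℝ) ^ (3 / 4 : ℝ)) * G D ∧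
      ENNReal.ofReal |logMahlerMeasure (linearForm D) - E₂ N D| ≤
        ENNReal.ofReal (2 * (2 : ℝ) ^ (1 / 4 : ℝ) / Real.sqrt N) * G D := by
  refine ⟨G_lt_top hD, fun N hN => ?_⟩
  have hc := c_pos hD
  by_cases hG : G D = ∞
  -- The constants must be shown positive, because 0 · ∞ = 0 in `ℝ≥0∞`; then both right-hand sides
  -- are ∞.
  · have hN0 : (0 : ℝ) < N := by exact_mod_cast hN
    have hΓ := Real.Gamma_pos_of_pos (show (0 : ℝ) < 3 / 4 by norm_num)
    rw [hG, ENNReal.mul_top (ENNReal.ofReal_pos.2 (by positivity)).ne',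
      ENNReal.mul_top (ENNReal.ofReal_pos.2 (by positivity)).ne']
    exact ⟨le_top, le_top⟩
  · exact ⟨ofReal_abs_sub_E₁_le hc hG hN, ofReal_abs_sub_E₂_le hc hG hN⟩
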